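/- Let $L=\mathbb Z\ltimes\bigoplus_{\mathbb Z}\mathbb Z/2\mathbb Z$ be the lamplighter group, $\mathbb Z$ acting by translation of the indices. Let $a$ be the standard generator of $\mathbb Z$, let $\varepsilon$ be the basis vector at index $0$, and let $u_i=a^i\varepsilon a^{-i}$ for $i\in\mathbb Z$ (the basis vector at index $i$). Let $\hat L$ be another copy of $L$, with isomorphism $g\mapsto\hat g$. For $\mathcal A\subseteq\mathbb Z$, let $L(\mathcal A)$ be the amalgamated product of $L$ and $\hat L$ in which $u_i$ is identified with $\hat u_i$ for each $i\in\mathcal A$ (the amalgamated subgroup being the one generated by the $u_i$, $i\in\mathcal A$). A finitely generated group $G$ is called, with respect to a finite generating tuple (the choice of which does not matter), - *r.e.* if it has a presentation on these generators with a recursively enumerable set of relators; - *co-r.e.* if there is an algorithm that recognizes the words on the generators that are non-trivial in $G$, i.e. the set of these words is recursively enumerable; - *effectively residually finite* if there is an algorithm (a partial recursive function) that takes a word $w$ on the generators as input, all of whose outputs describe morphisms from $G$ to finite groups (by the multiplication table of the finite group and the images of the generators), and which, whenever $w\ne 1$ in $G$, does halt and produces a morphism $\varphi$ with $\varphi(w)\neq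 1$. (If $w=1$ in $G$ the algorithm need not halt.) The profinite topology on $\mathbb Z$ is the topology that has the cosets $n+p\mathbb Z$ with $n,p\in\mathbb Z$, $p\ne 0$, as a basis of open sets. A set $O\subseteq\mathbb Z$ is *effectively open* if there is an algorithm that, given any $n\in O$, computes an integer $p\neq 0$ with $n+p\mathbb Z\subseteq O$ (nothing being required for $n\notin O$); a set is *effectively closed* if its complement is effectively open. A subset of $\mathbb Z$ is *co-r.e.* if its complement is recursively enumerable. **Proposition.** Let $\mathcal A$ be a subset of $\mathbb Z$. 1. $L(\mathcal A)$ is r.e., is co-r.e., or has solvable word problem if and only if $\mathcal A$ is, respectively, r.e., co-r.e., or recursive. 2. $L(\mathcal A)$ is residually finite if and only if $\mathcal A$ is closed in the profinite topology of $\mathbb Z$. 3. $L(\mathcal A)$ is effectively residually finite if and only if $\mathcal A$ is co-r.e. and effectively closed in the profinite topology of $\mathbb Z$. -/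

import Mathlib

/-! ### The lamplighter group and its amalgams -/

namespace Dyson

/-- The action of `ℤ` on `⨁_ℤ ℤ/2ℤ` (written multiplicatively) by translation of the indices:
the integer `n` sends the basis vector at `i` to the basis vector at `n + i`. -/
noncomputable def shift :
    Multiplicative ℤ →* MulAut (Multiplicative (ℤ →₀ ZMod 2)) where
  toFun n := AddEquiv.toMultiplicative (Finsupp.domCongr (Equiv.addLeft n.toAdd))
  map_one' := by
    refine MulEquiv.ext fun f => Multiplicative.toAdd.injective (Finsupp.ext fun i => ?_)
    simp [AddEquiv.toMultiplicative]
    rfl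
  map_mul' m n := by
    refine MulEquiv.ext fun f => Multiplicative.toAdd.injective (Finsupp.ext fun i => ?_)
    simp [AddEquiv.toMultiplicative]
    rfl

/-- The lamplighter group `L`, the semidirect product of `⨁_ℤ ℤ/2ℤ` by `ℤ`. -/
abbrev Lamplighter : Type :=
  Multiplicative (ℤ →₀ ZMod 2) ⋊[shift] Multiplicative ℤ

namespace Lamplighter

/-- The generator `a` of `L`: the generator of the acting copy of `ℤ`. -/
noncomputable def a : Lamplighter := SemidirectProduct.inr (Multiplicative.ofAdd 1)

/-- The generator `ε` of `L`: the basis vector at the index `0`. -/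
noncomputable def ε : Lamplighter :=
  SemidirectProduct.inl (Multiplicative.ofAdd (Finsupp.single 0 1))

/-- The element `u_i = a ^ i ε a ^ (-i)` of `L`. -/
noncomputable def u (i : ℤ) : Lamplighter := a ^ i * ε * a ^ (-i)

/-- `u_i` is the basis vector at the index `i`. -/
theorem u_eq (i : ℤ) :
    u i = SemidirectProduct.inl (Multiplicative.ofAdd (Finsupp.single i 1)) := by
  have h : (a ^ i : Lamplighter) = SemidirectProduct.inr (Multiplicative.ofAdd i) := by
    rw [a, ← map_zpow, ← ofAdd_zsmul]; simp
  rw [u, zpow_neg, h, ε, ← map_inv, ← SemidirectProduct.inl_aut]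
  congr 1
  refine Multiplicative.toAdd.injective ?_
  simp [shift, AddEquiv.toMultiplicative]

end Lamplighter

/-- The subgroup of `L` generated by the `u_i` with `i ∈ A`. -/
noncomputable def amalgamatedSubgroup (A : Set ℤ) : Subgroup Lamplighter :=
  Subgroup.closure (Lamplighter.u '' A)

/-- The group `L(A)`: the amalgamated product of two copies of the lamplighter group (indexed by
`Fin 2`) over the subgroup generated by the `u_i` with `i ∈ A`, so that the `u_i` of the first copy
is identified with the `u_i` of the second copy for `i ∈ A`. -/
abbrev DysonGroup (A : Set ℤ) : Type :=
  Monoid.PushoutI (ι := Fin 2) (G := fun _ => Lamplighter)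
    (fun _ => (amalgamatedSubgroup A).subtype)

end Dyson

/-! ### Algorithmic properties of finitely generated groups -/

/-- Words on `n` letters and their formal inverses: `(k, true)` is the letter `k` and `(k, false)`
its inverse. -/
abbrev GroupWord (n : ℕ) : Type := List (Fin n × Bool)

section Groups

variable {G : Type*} [Group G]

/-- The value in `G` of a word on the tuple `g` of elements of `G`. -/
def wordValue {n : ℕ} (g : Fin n → G) (w : GroupWord n) : G :=
  FreeGroup.lift g (FreeGroup.mk w)

/-- The tuple `g` generates the group `G`. -/
def Generates {n : ℕ} (g : Fin n → G) : Prop :=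
  Subgroup.closure (Set.range g) = ⊤

variable (G)

/-- An r.e. (that is, recursively presented) group: it has a presentation with finitely many
generators and a recursively enumerable set of relators. -/
def IsREGroup : Prop :=
  ∃ (n : ℕ) (g : Fin n → G), Generates g ∧
    ∃ R : Set (GroupWord n), REPred (fun w => w ∈ R) ∧
      Subgroup.normalClosure (FreeGroup.mk '' R) = (FreeGroup.lift g).ker

/-- A co-r.e. group: it is finitely generated and there is an algorithm that recognizes the words
on the generators that represent non-trivial elements. -/
def IsCoREGroup : Prop :=
  ∃ (n : ℕ) (g : Fin n → G), Generates g ∧ REPred (fun w : GroupWord n => wordValue g w ≠ 1)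

/-- A group with solvable word problem: it is finitely generated and there is an algorithm that
decides which words on the generators represent the identity. -/
def HasSolvableWordProblem : Prop :=
  ∃ (n : ℕ) (g : Fin n → G), Generates g ∧
    ComputablePred (fun w : GroupWord n => wordValue g w = 1)

variable {G}

/-- Finite descriptions of morphisms to finite groups: a multiplication table, given as the list of
its rows, and the list of the images of the generators. -/
abbrev MorphismCode : Type := List (List ℕ) × List ℕ

/-- The code `c` describes the morphism `φ` from `G`, with generating tuple `g`, to the finite group
`F`: for some numbering of the elements of `F` by `0, …, m - 1`, the first component of `c` is the
multiplication table of `F` and the second one lists the images of the generators. -/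
def Describes {n : ℕ} (g : Fin n → G) {F : Type} [Group F] (φ : G →* F) (c : MorphismCode) :
    Prop :=
  ∃ (m : ℕ) (e : F ≃ Fin m),
    c.1 = List.ofFn (fun i : Fin m =>
      List.ofFn (fun j : Fin m => (e (e.symm i * e.symm j) : ℕ))) ∧
    c.2 = List.ofFn (fun k : Fin n => (e (φ (g k)) : ℕ))

variable (G)

/-- An effectively residually finite group: it is finitely generated and there is an algorithm (a
partial recursive function `f`) that takes a word `w` on the generators as input, all of whose
outputs describe morphisms from `G` to finite groups, and which, if `w ≠ 1` in `G`, does produce a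
morphism `φ` with `φ w ≠ 1`. -/
def IsEffectivelyResiduallyFinite : Prop :=
  ∃ (n : ℕ) (g : Fin n → G), Generates g ∧
    ∃ f : GroupWord n →. MorphismCode, Partrec f ∧
      ∀ w : GroupWord n,
        (∀ c ∈ f w, ∃ (F : Type) (_ : Group F) (φ : G →* F), Describes g φ c) ∧
        (wordValue g w ≠ 1 →
          ∃ c ∈ f w, ∃ (F : Type) (_ : Group F) (φ : G →* F),
            Describes g φ c ∧ φ (wordValue g w) ≠ 1)

end Groups

/-! ### The profinite topology -/

/-- The profinite topology on an additive group: the cosets of the normal subgroups of finite index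
form a basis of open sets. -/
@[reducible] def profiniteTopology (G : Type*) [AddGroup G] : TopologicalSpace G :=
  TopologicalSpace.generateFrom
    {S : Set G | ∃ (N : AddSubgroup G) (x : G), N.Normal ∧ N.FiniteIndex ∧
      S = {y | ∃ k ∈ N, y = x + k}}

/-- A set of integers is effectively open in the profinite topology if there is an algorithm that,
given `n` in the set, computes a non-zero integer `p` such that `n + pℤ` is contained in the set
(nothing is required of the algorithm on the inputs that are not in the set). -/
def IsEffectivelyOpen (O : Set ℤ) : Prop :=
  ∃ f : ℤ →. ℤ, Partrec f ∧
    ∀ n ∈ O, ∃ p ∈ f n, p ≠ 0 ∧ ∀ k : ℤ, n + p * k ∈ O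

/-- A set of integers is effectively closed if its complement is effectively open. -/
def IsEffectivelyClosed (A : Set ℤ) : Prop :=
  IsEffectivelyOpen Aᶜ

/-! ### Recursively enumerable predicates -/

section Enumerable

variable {α β σ : Type*} [Primcodable α] [Primcodable β] [Primcodable σ]

/-! Write U for the subgroup generated by the u_i with i ∈ A. An element of L ∗ L is read as a walk
in L by right multiplication; a step of the second copy from p to px contributes [p][px]⁻¹ to a word
in symbols indexed by L (`Doubling.trace`), and a step of the first copy contributes nothing. The
element dies in L(A) iff the walk ends where it began and the word becomes trivial in the free group
on L/U (`Dyson.proj_eq_one_iff`). A walk of length ℓ stays in a box of radius ℓ, so only the indices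
in [-2ℓ, 2ℓ] matter for a word of length ℓ.

Finite quotients come from the same picture. Indices are reduced modulo a large p, U is replaced by
the lamps outside a set S of residues, and the word, still non-trivial, survives in a finite group
because free groups are residually finite. The outcome is `Dyson.exists_finite_separating`: given
non-zero moduli q n, a word w ≠ 1 of L(A) survives under a pair φ₁, φ₂ of morphisms from L to a
finite group which agree on u_i unless i ∈ n + (q n)ℤ for some n ∉ A with |n| ≤ 2ℓ.

If these progressions avoid A, the pair factors through L(A); this gives residual finiteness. If all
q n equal 4ℓ + 1, the pair agrees on the u_i with i ∈ A and |i| ≤ 2ℓ, which certifies w ≠ 1 as soon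
as finitely many indices are known to lie outside A; this gives the co-r.e. case. If the q n are
computed by an effective closedness algorithm, the certificate also proves that the pair factors
through L(A); this gives effective residual finiteness.

Conversely, u_i û_i⁻¹ is trivial iff i ∈ A, and words for these elements are computable from i on
any generating tuple, so algorithms for L(A) become algorithms for A. In a quotient of finite order
N, the images of u_i and û_i depend only on i mod N; hence a quotient that does not kill u_n û_n⁻¹
shows that n + Nℤ avoids A. -/

/-- Normal form for recursively enumerable predicates. -/
theorem REPred.exists_primrecRel {p : α → Prop} (hp : REPred p) :
    ∃ q : α → ℕ → Prop, PrimrecRel q ∧ (∀ a, p a ↔ ∃ k, q a k) ∧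
      ∀ a k l, k ≤ l → q a k → q a l := by
  obtain ⟨c, hc⟩ := Nat.Partrec.Code.exists_code.1 hp
  refine ⟨fun a k => (Nat.Partrec.Code.evaln k c (Encodable.encode a)).isSome = true, ?_, ?_, ?_⟩
  · refine Primrec.eq.comp (Primrec.option_isSome.comp ?_) (Primrec.const true)
    exact Nat.Partrec.Code.primrec_evaln.comp
      ((Primrec.snd.pair (Primrec.const c)).pair (Primrec.encode.comp Primrec.fst))
  · intro a
    have h1 : p a ↔ (Nat.Partrec.Code.eval c (Encodable.encode a)).Dom := by
      rw [hc]; simp [Part.assert]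
    rw [h1, Part.dom_iff_mem]
    simp only [Nat.Partrec.Code.evaln_complete, Option.isSome_iff_exists, Option.mem_def]
    exact exists_comm
  · intro a k l hkl h
    obtain ⟨x, hx⟩ := Option.isSome_iff_exists.1 h
    exact Option.isSome_iff_exists.2 ⟨x, Nat.Partrec.Code.evaln_mono hkl hx⟩

/-- A partial recursive choice function for the projection of a primitive recursive relation. -/
theorem PrimrecRel.exists_partrec {q : α → ℕ → Prop} (hq : PrimrecRel q) :
    ∃ f : α →. ℕ, Partrec f ∧ (∀ a, ∀ k ∈ f a, q a k) ∧ ∀ a, (∃ k, q a k) → (f a).Dom := by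
  obtain ⟨hd, hq'⟩ := hq
  refine ⟨fun a => Nat.rfind fun k => Part.some (@decide (q a k) (hd (a, k))), ?_, ?_, ?_⟩
  · refine Partrec.rfind ?_
    exact hq'.to_comp.partrec
  · intro a k hk
    simpa using Nat.rfind_spec hk
  · rintro a ⟨k, hk⟩
    apply Nat.rfind_dom.2
    exact ⟨k, by simpa using hk, fun _ => trivial⟩

theorem PrimrecRel.re_exists {q : α → ℕ → Prop} (hq : PrimrecRel q) :
    REPred fun a => ∃ k, q a k := by
  obtain ⟨f, hf, h1, h2⟩ := hq.exists_partrec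
  exact hf.dom_re.of_eq fun a => ⟨fun h => ⟨_, h1 a _ (Part.get_mem h)⟩, h2 a⟩

theorem PrimrecPred.re {p : α → Prop} (hp : PrimrecPred p) : REPred p :=
  hp.computablePred.to_re

theorem REPred.comp {p : β → Prop} (hp : REPred p) {f : α → β} (hf : Computable f) :
    REPred fun a => p (f a) :=
  Partrec.comp hp hf

theorem REPred.and {p q : α → Prop} (hp : REPred p) (hq : REPred q) :
    REPred fun a => p a ∧ q a := by
  have := Partrec.bind hp (g := fun a _ => Part.assert (q a) fun _ => Part.some ())
    (Partrec.comp hq Computable.fst)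
  refine this.dom_re.of_eq fun a => ?_
  simp [Part.dom_iff_mem]

/-- The two searches have to run in parallel; the normal form merges them into one search over a
common step bound. -/
theorem REPred.or {p q : α → Prop} (hp : REPred p) (hq : REPred q) :
    REPred fun a => p a ∨ q a := by
  obtain ⟨r, hr, h1, -⟩ := hp.exists_primrecRel
  obtain ⟨s, hs, h2, -⟩ := hq.exists_primrecRel
  refine (PrimrecRel.re_exists (q := fun a k => r a k ∨ s a k) (PrimrecPred.or hr hs)).of_eq
    fun a => ?_
  rw [h1, h2, exists_or]

/-- A partial recursive choice function for the projection of an r.e. relation. -/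
theorem REPred.exists_partrec {p : α × β → Prop} (hp : REPred p) :
    ∃ f : α →. β, Partrec f ∧ (∀ a, ∀ b ∈ f a, p (a, b)) ∧ ∀ a, (∃ b, p (a, b)) → (f a).Dom := by
  obtain ⟨q, hq, h1, -⟩ := hp.exists_primrecRel
  -- k codes a candidate b together with a step bound; a k that decodes to no b gives the empty list
  -- and fails.
  let r : α → ℕ → Prop := fun a k => ∃ b ∈ (Encodable.decode (α := β) k.unpair.1).toList,
    q (a, b) k.unpair.2
  have hr : PrimrecRel r := by
    have : PrimrecRel fun (b : β) (y : α × ℕ) => q (y.1, b) y.2 :=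
      hq.comp ((Primrec.fst.comp Primrec.snd).pair Primrec.fst) (Primrec.snd.comp Primrec.snd)
    exact this.exists_mem_list.comp
      (Primrec.optionToList.comp (Primrec.decode.comp (Primrec.fst.comp
        (Primrec.unpair.comp Primrec.snd))))
      (Primrec.fst.pair (Primrec.snd.comp (Primrec.unpair.comp Primrec.snd)))
  obtain ⟨f, hf, h2, h3⟩ := hr.exists_partrec
  refine ⟨fun a => (f a).bind fun k => (Encodable.decode (α := β) k.unpair.1 : Part β), ?_, ?_, ?_⟩
  · refine hf.bind ?_
    exact Computable.ofOption (Computable.decode.comp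
      (Computable.fst.comp (Computable.unpair.comp Computable.snd)))
  · intro a b hb
    simp only [Part.mem_bind_iff, Part.mem_coe] at hb
    obtain ⟨k, hk, hb⟩ := hb
    obtain ⟨b', hb', hq'⟩ := h2 a k hk
    simp only [Option.mem_toList, Option.mem_def] at hb' hb
    rw [hb] at hb'
    cases hb'
    exact (h1 _).2 ⟨_, hq'⟩
  · rintro a ⟨b, hb⟩
    obtain ⟨l, hl⟩ := (h1 _).1 hb
    have hd : (f a).Dom := h3 a ⟨Nat.pair (Encodable.encode b) l, b, by simp, by simpa using hl⟩
    refine ⟨hd, ?_⟩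
    obtain ⟨b', hb', -⟩ := h2 a _ (Part.get_mem hd)
    simp only [Option.mem_toList] at hb'
    change (Encodable.decode (α := β) _ : Part β).Dom
    rw [hb']
    trivial

theorem REPred.exists {p : α × β → Prop} (hp : REPred p) : REPred fun a => ∃ b, p (a, b) := by
  obtain ⟨f, hf, h1, h2⟩ := hp.exists_partrec
  exact hf.dom_re.of_eq fun a => ⟨fun h => ⟨_, h1 a _ (Part.get_mem h)⟩, h2 a⟩

/-- Monotonicity in the step bound lets a single bound, the maximum, serve all members of the list.
-/
theorem REPred.forall_mem_list {p : α × β → Prop} (hp : REPred p) {l : α → List β}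
    (hl : Primrec l) : REPred fun a => ∀ b ∈ l a, p (a, b) := by
  obtain ⟨q, hq, h1, h2⟩ := hp.exists_primrecRel
  have hr : PrimrecRel fun (b : β) (y : α × ℕ) => q (y.1, b) y.2 :=
    hq.comp ((Primrec.fst.comp Primrec.snd).pair Primrec.fst) (Primrec.snd.comp Primrec.snd)
  have hs : PrimrecRel fun (a : α) (k : ℕ) => ∀ b ∈ l a, q (a, b) k :=
    hr.forall_mem_list.comp (hl.comp Primrec.fst) Primrec.id
  refine hs.re_exists.of_eq fun a => ?_
  simp only [h1]
  generalize l a = L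
  induction L with
  | nil => simp
  | cons b L ih =>
    simp only [List.forall_mem_cons]
    constructor
    · rintro ⟨k, hk, hk'⟩
      exact ⟨⟨k, hk⟩, ih.1 ⟨k, hk'⟩⟩
    · rintro ⟨⟨k, hk⟩, h⟩
      obtain ⟨l, hl⟩ := ih.2 h
      exact ⟨max k l, h2 _ _ _ (le_max_left _ _) hk,
        fun x hx => h2 _ _ _ (le_max_right _ _) (hl x hx)⟩

theorem REPred.mem_graph {f : α →. β} (hf : Partrec f) :
    REPred fun x : α × β => x.2 ∈ f x.1 := by
  classical
  have h : Partrec fun x : α × β => (f x.1).bind fun b =>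
      Part.assert (b = x.2) fun _ => Part.some () := by
    refine (hf.comp Computable.fst).bind ?_
    exact REPred.comp (p := fun y : β × β => y.1 = y.2) (Primrec.eq (α := β)).re
      (Computable.snd.pair (Computable.snd.comp Computable.fst))
  refine h.dom_re.of_eq fun x => ?_
  simp [Part.dom_iff_mem]

end Enumerable

/-! ### Primitive recursive arithmetic on the integers -/

section IntPrimrec

theorem Int.encode_natCast (n : ℕ) : Encodable.encode (n : ℤ) = 2 * n := rfl

theorem Int.encode_negSucc (n : ℕ) : Encodable.encode (Int.negSucc n) = 2 * n + 1 := rfl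

theorem Primrec.int_natCast : Primrec (fun n : ℕ => (n : ℤ)) :=
  Primrec.encode_iff.1 (Primrec.nat_double.of_eq fun _ => rfl)

theorem Primrec.int_negSucc : Primrec Int.negSucc :=
  Primrec.encode_iff.1 (Primrec.nat_double_succ.of_eq fun _ => rfl)

theorem Primrec.int_toNat : Primrec Int.toNat := by
  -- The parity of the code of an integer is its sign bit.
  refine (Primrec.cond (Primrec.nat_bodd.comp Primrec.encode) (Primrec.const 0)
    (Primrec.nat_div2.comp Primrec.encode)).of_eq fun n => ?_
  cases n with
  | ofNat n => simp [Int.encode_natCast]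
  | negSucc n => simp [Int.encode_negSucc]

theorem Primrec.int_neg : Primrec (fun n : ℤ => -n) := by
  refine (Primrec.cond (Primrec.nat_bodd.comp Primrec.encode)
    (Primrec.int_natCast.comp (Primrec.succ.comp (Primrec.nat_div2.comp Primrec.encode)))
    (Primrec.nat_casesOn (Primrec.nat_div2.comp Primrec.encode) (Primrec.const 0)
      (Primrec.int_negSucc.comp₂ Primrec₂.right))).of_eq fun n => ?_
  cases n with
  | ofNat n =>
    simp only [Int.ofNat_eq_natCast, Int.encode_natCast]
    cases n <;> simp [Int.negSucc_eq]
  | negSucc n => simp only [Int.encode_negSucc]; simp [Int.neg_negSucc]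

theorem Primrec.int_natAbs : Primrec Int.natAbs :=
  (Primrec.nat_add.comp Primrec.int_toNat (Primrec.int_toNat.comp Primrec.int_neg)).of_eq
    fun n => by omega

theorem Primrec.int_subNat : Primrec₂ fun m n : ℕ => (m : ℤ) - n := by
  refine (Primrec.ite (PrimrecRel.comp Primrec.nat_le Primrec.snd Primrec.fst)
    (Primrec.int_natCast.comp (Primrec.nat_sub.comp Primrec.fst Primrec.snd))
    (Primrec.int_neg.comp (Primrec.int_natCast.comp
      (Primrec.nat_sub.comp Primrec.snd Primrec.fst)))).of_eq fun x => ?_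
  dsimp only
  split_ifs <;> omega

theorem Primrec.int_sub : Primrec₂ fun m n : ℤ => m - n := by
  refine (Primrec.int_subNat.comp
    (Primrec.nat_add.comp (Primrec.int_toNat.comp Primrec.fst)
      (Primrec.int_toNat.comp (Primrec.int_neg.comp Primrec.snd)))
    (Primrec.nat_add.comp (Primrec.int_toNat.comp (Primrec.int_neg.comp Primrec.fst))
      (Primrec.int_toNat.comp Primrec.snd))).of_eq fun x => ?_
  dsimp only
  omega

theorem PrimrecRel.nat_dvd : PrimrecRel fun m n : ℕ => m ∣ n :=
  (Primrec.eq.comp (Primrec.nat_mod.comp Primrec.snd Primrec.fst) (Primrec.const 0)).of_eq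
    fun _ => (Nat.dvd_iff_mod_eq_zero ..).symm

theorem PrimrecRel.int_dvd : PrimrecRel fun m n : ℤ => m ∣ n :=
  (PrimrecRel.nat_dvd.comp (Primrec.int_natAbs.comp Primrec.fst)
    (Primrec.int_natAbs.comp Primrec.snd)).of_eq fun _ => Int.natAbs_dvd_natAbs

end IntPrimrec

/-! ### Words -/

section Words

variable {n : ℕ}

/-- A word representing the `i`-th power of the element represented by `w`. -/
def wordPow (w : GroupWord n) (i : ℤ) : GroupWord n :=
  (List.range i.toNat).flatMap (fun _ => w) ++
    (List.range (-i).toNat).flatMap (fun _ => FreeGroup.invRev w)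

/-- A word for the conjugate of `e` by the `i`-th power of `a`. -/
def wordConj (a e : GroupWord n) (i : ℤ) : GroupWord n :=
  wordPow a i ++ e ++ FreeGroup.invRev (wordPow a i)

theorem Primrec.invRev : Primrec (FreeGroup.invRev : GroupWord n → GroupWord n) :=
  Primrec.list_reverse.comp (Primrec.list_map Primrec.id
    ((Primrec.fst.comp Primrec.snd).pair (Primrec.not.comp (Primrec.snd.comp Primrec.snd))))

theorem Primrec.wordPow (w : GroupWord n) : Primrec (_root_.wordPow w) :=
  Primrec.list_append.comp
    (Primrec.list_flatMap (Primrec.list_range.comp Primrec.int_toNat) (Primrec.const w))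
    (Primrec.list_flatMap (Primrec.list_range.comp (Primrec.int_toNat.comp Primrec.int_neg))
      (Primrec.const _))

theorem Primrec.wordConj (a e : GroupWord n) : Primrec (_root_.wordConj a e) :=
  Primrec.list_append.comp
    (Primrec.list_append.comp (Primrec.wordPow a) (Primrec.const e))
    (Primrec.invRev.comp (Primrec.wordPow a))

section Value

variable {G H : Type*} [Group G] [Group H] (g : Fin n → G)

theorem wordValue_append (v w : GroupWord n) :
    wordValue g (v ++ w) = wordValue g v * wordValue g w := by
  simp [wordValue, ← FreeGroup.mul_mk]

@[simp] theorem wordValue_nil : wordValue g [] = 1 := by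
  simp [wordValue]

theorem wordValue_invRev (w : GroupWord n) :
    wordValue g (FreeGroup.invRev w) = (wordValue g w)⁻¹ := by
  rw [wordValue, ← FreeGroup.inv_mk, map_inv, wordValue]

theorem wordValue_cons (x : Fin n × Bool) (w : GroupWord n) :
    wordValue g (x :: w) = (cond x.2 (g x.1) (g x.1)⁻¹) * wordValue g w := by
  simp [wordValue]

theorem wordValue_singleton (k : Fin n) : wordValue g [(k, true)] = g k := by
  simp [wordValue]

theorem wordValue_flatMap_range (w : GroupWord n) (m : ℕ) :
    wordValue g ((List.range m).flatMap fun _ => w) = wordValue g w ^ m := by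
  induction m with
  | zero => simp
  | succ m ih => rw [List.range_succ, List.flatMap_append, wordValue_append, ih, pow_succ]; simp

theorem wordValue_wordPow (w : GroupWord n) (i : ℤ) :
    wordValue g (wordPow w i) = wordValue g w ^ i := by
  rw [wordPow, wordValue_append, wordValue_flatMap_range, wordValue_flatMap_range,
    wordValue_invRev, inv_pow, ← zpow_natCast, ← zpow_natCast, ← zpow_neg, ← zpow_add]
  congr 1
  omega

theorem wordValue_wordConj (a e : GroupWord n) (i : ℤ) :
    wordValue g (wordConj a e i) =
      wordValue g a ^ i * wordValue g e * wordValue g a ^ (-i) := by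
  rw [wordConj, wordValue_append, wordValue_append, wordValue_invRev, wordValue_wordPow, zpow_neg]

theorem map_wordValue (φ : G →* H) (w : GroupWord n) :
    φ (wordValue g w) = wordValue (fun k => φ (g k)) w := by
  induction w with
  | nil => simp
  | cons x w ih =>
    rw [wordValue_cons, wordValue_cons, map_mul, ih]
    cases x.2 <;> simp

theorem Generates.exists_wordValue {g : Fin n → G} (hg : Generates g) (x : G) :
    ∃ w, wordValue g w = x := by
  have h : x ∈ (FreeGroup.lift g).range := by
    rw [FreeGroup.range_lift_eq_closure, hg]
    trivial
  obtain ⟨y, rfl⟩ := h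
  exact ⟨y.toWord, by rw [wordValue, FreeGroup.mk_toWord]⟩

end Value

/-! ### Computability in free groups -/

/-- Reduction is a right fold: a letter put in front of a reduced tail can only cancel against the
head of that tail. -/
theorem Primrec.freeGroup_reduce {α : Type*} [Primcodable α] [DecidableEq α] :
    Primrec (FreeGroup.reduce : List (α × Bool) → List (α × Bool)) := by
  have hc : Primrec fun p : List (α × Bool) × ((α × Bool) × List (α × Bool)) =>
      List.casesOn (motive := fun _ => List (α × Bool)) p.2.2 [p.2.1] fun y t =>
        if p.2.1.1 = y.1 ∧ p.2.1.2 = !y.2 then t else p.2.1 :: y :: t := by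
    refine Primrec.list_casesOn (h := fun (p : List (α × Bool) × ((α × Bool) × List (α × Bool)))
      (q : (α × Bool) × List (α × Bool)) =>
      if p.2.1.1 = q.1.1 ∧ p.2.1.2 = !q.1.2 then q.2 else p.2.1 :: q.1 :: q.2)
      (Primrec.snd.comp Primrec.snd)
      ((Primrec.list_cons (α := α × Bool)).comp (Primrec.fst.comp Primrec.snd)
        (Primrec.const [])) ?_
    have hx : Primrec fun p : (List (α × Bool) × ((α × Bool) × List (α × Bool))) ×
        ((α × Bool) × List (α × Bool)) => p.1.2.1 :=
      Primrec.fst.comp (Primrec.snd.comp Primrec.fst)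
    have hy : Primrec fun p : (List (α × Bool) × ((α × Bool) × List (α × Bool))) ×
        ((α × Bool) × List (α × Bool)) => p.2.1 := Primrec.fst.comp Primrec.snd
    have ht : Primrec fun p : (List (α × Bool) × ((α × Bool) × List (α × Bool))) ×
        ((α × Bool) × List (α × Bool)) => p.2.2 := Primrec.snd.comp Primrec.snd
    refine Primrec.ite (PrimrecPred.and
      (Primrec.eq.comp (Primrec.fst.comp hx) (Primrec.fst.comp hy))
      (Primrec.eq.comp (Primrec.snd.comp hx) (Primrec.not.comp (Primrec.snd.comp hy))))
      ht (Primrec.list_cons.comp hx (Primrec.list_cons.comp hy ht))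
  have h := Primrec.list_foldr (α := List (α × Bool)) Primrec.id (Primrec.const []) hc.to₂
  refine h.of_eq fun l => ?_
  induction l with
  | nil => rfl
  | cons x l ih =>
    rw [FreeGroup.reduce.cons, ← ih]
    rfl

theorem PrimrecRel.freeGroup_mk_eq :
    PrimrecRel fun v w : GroupWord n => FreeGroup.mk v = FreeGroup.mk w :=
  (Primrec.eq.comp (Primrec.freeGroup_reduce.comp Primrec.fst)
    (Primrec.freeGroup_reduce.comp Primrec.snd)).of_eq fun _ =>
      ⟨fun h => FreeGroup.reduce.exact h, fun h => FreeGroup.reduce.sound h⟩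

/-- The product of the conjugates of the words, or of their inverses, listed by `l`. -/
def wordConjProd (l : List ((GroupWord n × GroupWord n) × Bool)) : GroupWord n :=
  l.flatMap fun x => x.1.1 ++ (cond x.2 x.1.2 (FreeGroup.invRev x.1.2)) ++ FreeGroup.invRev x.1.1

theorem Primrec.wordConjProd : Primrec (_root_.wordConjProd (n := n)) := by
  refine Primrec.list_flatMap Primrec.id ?_
  have h1 : Primrec fun p : List ((GroupWord n × GroupWord n) × Bool) ×
      ((GroupWord n × GroupWord n) × Bool) => p.2.1.1 :=
    Primrec.fst.comp (Primrec.fst.comp Primrec.snd)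
  have h2 : Primrec fun p : List ((GroupWord n × GroupWord n) × Bool) ×
      ((GroupWord n × GroupWord n) × Bool) => p.2.1.2 :=
    Primrec.snd.comp (Primrec.fst.comp Primrec.snd)
  exact Primrec.list_append.comp (Primrec.list_append.comp h1
    (Primrec.cond (Primrec.snd.comp Primrec.snd) h2 (Primrec.invRev.comp h2)))
    (Primrec.invRev.comp h1)

/-- Lists can be enumerated, so this makes the normal closure of an r.e. set r.e. Such products are
closed under inversion: reverse the list and flip the signs. -/
theorem FreeGroup.mem_normalClosure_iff (R : Set (GroupWord n)) (x : FreeGroup (Fin n)) :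
    x ∈ Subgroup.normalClosure (FreeGroup.mk '' R) ↔
      ∃ l : List ((GroupWord n × GroupWord n) × Bool), (∀ y ∈ l, y.1.2 ∈ R) ∧
        FreeGroup.mk (wordConjProd l) = x := by
  have key : ∀ y : (GroupWord n × GroupWord n) × Bool,
      FreeGroup.mk (y.1.1 ++ (cond y.2 y.1.2 (FreeGroup.invRev y.1.2)) ++
        FreeGroup.invRev y.1.1) = FreeGroup.mk y.1.1 *
          (cond y.2 (FreeGroup.mk y.1.2) (FreeGroup.mk y.1.2)⁻¹) * (FreeGroup.mk y.1.1)⁻¹ := by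
    rintro ⟨y, b⟩
    cases b <;> simp [← FreeGroup.mul_mk, ← FreeGroup.inv_mk, mul_assoc]
  constructor
  · intro hx
    refine Subgroup.closure_induction (p := fun x _ => ∃ l : List ((GroupWord n × GroupWord n) ×
      Bool), (∀ y ∈ l, y.1.2 ∈ R) ∧ FreeGroup.mk (wordConjProd l) = x) ?_ ?_ ?_ ?_ hx
    · intro x hx
      obtain ⟨_, ⟨r, hr, rfl⟩, hc⟩ := Group.mem_conjugatesOfSet_iff.1 hx
      obtain ⟨c, rfl⟩ := isConj_iff.1 hc
      refine ⟨[((c.toWord, r), true)], by simpa using hr, ?_⟩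
      simp only [wordConjProd, List.flatMap_singleton]
      rw [key ((c.toWord, r), true)]
      simp [FreeGroup.mk_toWord]
    · exact ⟨[], by simp, rfl⟩
    · rintro _ _ _ _ ⟨l, hl, rfl⟩ ⟨m, hm, rfl⟩
      refine ⟨l ++ m, ?_, ?_⟩
      · intro y hy
        rcases List.mem_append.1 hy with hy | hy
        exacts [hl y hy, hm y hy]
      · simp [wordConjProd, ← FreeGroup.mul_mk]
    · rintro x' - ⟨l, hl, rfl⟩
      refine ⟨(l.map fun y => (y.1, !y.2)).reverse, ?_, ?_⟩
      · intro y hy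
        simp only [List.mem_reverse, List.mem_map] at hy
        obtain ⟨z, hz, rfl⟩ := hy
        exact hl z hz
      · clear hl
        induction l with
        | nil => simp [wordConjProd, ← FreeGroup.one_eq_mk]
        | cons y l ih =>
          simp only [wordConjProd, List.map_cons, List.reverse_cons, List.flatMap_append,
            List.flatMap_cons, List.flatMap_nil, List.append_nil] at ih ⊢
          rw [← FreeGroup.mul_mk, ih, ← FreeGroup.mul_mk (L₂ := List.flatMap _ _), mul_inv_rev,
            key, key ((y.1, !y.2))]
          cases y.2 <;> simp
  · rintro ⟨l, hl, rfl⟩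
    induction l with
    | nil => exact Subgroup.one_mem _
    | cons y l ih =>
      simp only [wordConjProd, List.flatMap_cons] at ih ⊢
      rw [← FreeGroup.mul_mk, key]
      refine Subgroup.mul_mem _ (Subgroup.normalClosure_normal.conj_mem _ ?_ _)
        (ih fun z hz => hl z (List.mem_cons_of_mem _ hz))
      have hy : FreeGroup.mk y.1.2 ∈ Subgroup.normalClosure (FreeGroup.mk '' R) :=
        Subgroup.subset_normalClosure ⟨_, hl y List.mem_cons_self, rfl⟩
      cases y.2
      · exact Subgroup.inv_mem _ hy
      · exact hy

theorem REPred.mem_normalClosure {R : Set (GroupWord n)} (hR : REPred fun w => w ∈ R) :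
    REPred fun w : GroupWord n =>
      FreeGroup.mk w ∈ Subgroup.normalClosure (FreeGroup.mk '' R) := by
  have h : REPred fun p : GroupWord n × List ((GroupWord n × GroupWord n) × Bool) =>
      (∀ y ∈ p.2, y.1.2 ∈ R) ∧ FreeGroup.mk (wordConjProd p.2) = FreeGroup.mk p.1 := by
    refine REPred.and ?_ ?_
    · exact REPred.forall_mem_list (p := fun q : (GroupWord n × List ((GroupWord n × GroupWord n) ×
        Bool)) × ((GroupWord n × GroupWord n) × Bool) => q.2.1.2 ∈ R)
        (hR.comp (Primrec.snd.comp (Primrec.fst.comp Primrec.snd)).to_comp) Primrec.snd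
    · exact (PrimrecRel.freeGroup_mk_eq.comp (Primrec.wordConjProd.comp Primrec.snd)
        Primrec.fst).re
  exact h.exists.of_eq fun w => (FreeGroup.mem_normalClosure_iff R (FreeGroup.mk w)).symm

end Words

/-- In a recursively presented group the set of words representing the identity is r.e. -/
theorem IsREGroup.exists_generates {G : Type*} [Group G] (h : IsREGroup G) :
    ∃ (n : ℕ) (g : Fin n → G), Generates g ∧
      REPred fun w : GroupWord n => wordValue g w = 1 := by
  obtain ⟨n, g, hg, R, hR, h⟩ := h
  refine ⟨n, g, hg, hR.mem_normalClosure.of_eq fun w => ?_⟩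
  rw [h, MonoidHom.mem_ker]
  rfl

/-! ### Free products of two copies of a group and wreath products -/

namespace Doubling

open Monoid.Coprod

variable {L P Q K : Type*} [Group L] [Group P] [Group Q] [Group K]

/-- The homomorphism from `L ∗ L` to the wreath product of `Q` by `P` which is `π` on the first
factor, and the conjugate of `π` by an element of the base group, given by `s`, on the second. -/
def wreathConj (π : L →* P) (s : P → Q) : Monoid.Coprod L L →* RegularWreathProduct Q P :=
  Monoid.Coprod.lift (RegularWreathProduct.inl.comp π)
    ((MulAut.conj (⟨fun y => s y⁻¹, 1⟩ : RegularWreathProduct Q P)).toMonoidHom.comp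
      (RegularWreathProduct.inl.comp π))

variable (π : L →* P) (s : P → Q)

@[simp] theorem wreathConj_inl_left (x : L) (y : P) : (wreathConj π s (inl x)).left y = 1 := by
  simp [wreathConj]

@[simp] theorem wreathConj_inl_right (x : L) : (wreathConj π s (inl x)).right = π x := by
  simp [wreathConj]

@[simp] theorem wreathConj_inr_left (x : L) (y : P) :
    (wreathConj π s (inr x)).left y = s y⁻¹ * (s (y⁻¹ * π x))⁻¹ := by
  simp [wreathConj]

@[simp] theorem wreathConj_inr_right (x : L) : (wreathConj π s (inr x)).right = π x := by
  simp [wreathConj]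

/-- The word on the elements of `L` attached to an element of `L ∗ L`, starting from `y⁻¹`. -/
def trace (w : Monoid.Coprod L L) (y : L) : FreeGroup L :=
  (wreathConj (MonoidHom.id L) FreeGroup.of w).left y

/-- The folding map from `L ∗ L` to `L`. -/
def fold : Monoid.Coprod L L →* L := Monoid.Coprod.lift (MonoidHom.id L) (MonoidHom.id L)

theorem wreathConj_right (w : Monoid.Coprod L L) : (wreathConj π s w).right = π (fold w) := by
  induction w using Monoid.Coprod.induction_on with
  | inl x => simp [fold]
  | inr x => simp [fold]
  | mul v w hv hw => simp [hv, hw]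

@[simp] theorem trace_inl (x y : L) : trace (inl x) y = 1 := by
  simp [trace]

@[simp] theorem trace_inr (x y : L) :
    trace (inr x) y = FreeGroup.of y⁻¹ * (FreeGroup.of (y⁻¹ * x))⁻¹ := by
  simp [trace]

/-- The second walk starts at the end point of the first one, y⁻¹ · fold v. -/
theorem trace_mul (v w : Monoid.Coprod L L) (y : L) :
    trace (v * w) y = trace v y * trace w ((fold v)⁻¹ * y) := by
  simp [trace, wreathConj_right]

/-- `trace` is universal: π transports the walk and s evaluates its symbols, so every choice of π
and s is controlled by the same word. -/
theorem wreathConj_left (w : Monoid.Coprod L L) (y : L) :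
    (wreathConj π s w).left (π y) = FreeGroup.lift (s ∘ π) (trace w y) := by
  induction w using Monoid.Coprod.induction_on generalizing y with
  | inl x => simp
  | inr x => simp
  | mul v w hv hw =>
    rw [trace_mul, map_mul (FreeGroup.lift _), ← hv, ← hw, map_mul (wreathConj π s),
      RegularWreathProduct.mul_left, Pi.mul_apply,
      wreathConj_right, map_mul, map_inv]

/-- An element of `L ∗ L` that becomes trivial when the two copies of `U` are identified. -/
def IsTrivialOver (U : Subgroup L) (w : Monoid.Coprod L L) : Prop :=
  fold w = 1 ∧ FreeGroup.map (QuotientGroup.mk (s := U)) (trace w 1) = 1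

/-- Since φ₁ and φ₂ agree on U, the element φ₁ x (φ₂ x)⁻¹ depends only on the coset xU. Evaluating
the trace at these elements gives the image of w, up to a conjugation and the factor φ₁ (fold w). -/
theorem IsTrivialOver.lift_eq_one {U : Subgroup L} {w : Monoid.Coprod L L}
    (hw : IsTrivialOver U w) {φ₁ φ₂ : L →* K} (h : ∀ u ∈ U, φ₁ u = φ₂ u) :
    Monoid.Coprod.lift φ₁ φ₂ w = 1 := by
  have hwd : ∀ x y : L, QuotientGroup.leftRel U x y →
      φ₁ x * (φ₂ x)⁻¹ = φ₁ y * (φ₂ y)⁻¹ := by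
    intro x y hxy
    have := h _ (QuotientGroup.leftRel_apply.1 hxy)
    rw [map_mul, map_mul, map_inv, map_inv, inv_mul_eq_iff_eq_mul] at this
    rw [this]
    group
  let r : L ⧸ U → K := Quotient.lift (fun x => φ₁ x * (φ₂ x)⁻¹) hwd
  have hr : ∀ x : L, r (QuotientGroup.mk x) = φ₁ x * (φ₂ x)⁻¹ := fun x => rfl
  have key : ∀ (v : Monoid.Coprod L L) (y : L),
      FreeGroup.lift r (FreeGroup.map (QuotientGroup.mk (s := U)) (trace v y)) =
        (φ₁ y)⁻¹ * Monoid.Coprod.lift φ₁ φ₂ v * (φ₁ (fold v))⁻¹ * φ₁ y := by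
    intro v
    induction v using Monoid.Coprod.induction_on with
    | inl x => intro y; simp [fold]
    | inr x => intro y; simp [fold, hr, mul_assoc]
    | mul v w hv hw =>
      intro y
      rw [trace_mul, map_mul, map_mul, hv, hw]
      simp [mul_assoc]
  have h1 := key w 1
  rw [hw.2, hw.1] at h1
  simpa using h1.symm

/-- This lets the representation descend to the amalgam: it suffices that s be constant on the left
cosets of a subgroup containing the images of the amalgamated elements. -/
theorem wreathConj_inl_eq_inr {u : L} (h : ∀ y, s (y * π u) = s y) :
    wreathConj π s (inl u) = wreathConj π s (inr u) := by
  ext1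
  · ext y
    simp [h]
  · simp

theorem isTrivialOver_of_wreathConj {U : Subgroup L} {w : Monoid.Coprod L L}
    (h : wreathConj (MonoidHom.id L) (fun x => FreeGroup.of (QuotientGroup.mk (s := U) x)) w = 1) :
    IsTrivialOver U w := by
  refine ⟨?_, ?_⟩
  · have := wreathConj_right (MonoidHom.id L)
      (fun x => FreeGroup.of (QuotientGroup.mk (s := U) x)) w
    rw [h] at this
    exact this.symm
  · have := wreathConj_left (MonoidHom.id L)
      (fun x => FreeGroup.of (QuotientGroup.mk (s := U) x)) w 1
    rw [h] at this
    rw [FreeGroup.map_eq_lift]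
    exact this.symm

end Doubling

/-! ### Comparing identifications of free generators -/

section FreeGroupMap

/-- A map on generators that identifies no more than another one has a smaller kernel. -/
theorem FreeGroup.map_eq_one_of_map_eq_one {X Y Z : Type*} {V : Set X} {x : FreeGroup X}
    (hx : x ∈ Subgroup.closure (FreeGroup.of '' V)) {φ : X → Y} {ψ : X → Z}
    (h : ∀ v ∈ V, ∀ v' ∈ V, ψ v = ψ v' → φ v = φ v') (h1 : FreeGroup.map ψ x = 1) :
    FreeGroup.map φ x = 1 := by
  classical
  -- On V the map φ factors through ψ, by choosing a preimage in V of each label; the value 1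
  -- outside ψ(V) plays no role.
  let e : Z → FreeGroup Y := fun z =>
    if hz : ∃ v ∈ V, ψ v = z then FreeGroup.of (φ hz.choose) else 1
  have he : Set.EqOn (FreeGroup.map φ) ((FreeGroup.lift e).comp (FreeGroup.map ψ))
      (Subgroup.closure (FreeGroup.of '' V)) := by
    refine MonoidHom.eqOn_closure ?_
    rintro _ ⟨v, hv, rfl⟩
    have hz : ∃ v' ∈ V, ψ v' = ψ v := ⟨v, hv, rfl⟩
    simp only [FreeGroup.map.of, MonoidHom.comp_apply, FreeGroup.lift_apply_of, e, dif_pos hz]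
    rw [h _ hz.choose_spec.1 v hv hz.choose_spec.2]
  rw [he hx, MonoidHom.comp_apply, h1, _root_.map_one]

end FreeGroupMap

namespace Doubling

variable {L : Type*} [Group L]

/-- The trace sees U only through the coincidences among the cosets of the letters that it uses. -/
theorem IsTrivialOver.mono {U U' : Subgroup L} {w : Monoid.Coprod L L} (hw : IsTrivialOver U w)
    {V : Set L} (hV : trace w 1 ∈ Subgroup.closure (FreeGroup.of '' V))
    (h : ∀ v ∈ V, ∀ v' ∈ V, v⁻¹ * v' ∈ U → v⁻¹ * v' ∈ U') : IsTrivialOver U' w :=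
  ⟨hw.1, FreeGroup.map_eq_one_of_map_eq_one hV
    (fun v hv v' hv' e => QuotientGroup.eq.2 (h v hv v' hv' (QuotientGroup.eq.1 e))) hw.2⟩

end Doubling

/-! ### Homomorphisms from the lamplighter group and its amalgams -/

namespace Dyson

open Lamplighter

theorem shift_ofAdd_single (n i : ℤ) (c : ZMod 2) :
    shift (Multiplicative.ofAdd n) (Multiplicative.ofAdd (Finsupp.single i c)) =
      Multiplicative.ofAdd (Finsupp.single (n + i) c) := by
  refine Multiplicative.toAdd.injective ?_
  simp [shift, AddEquiv.toMultiplicative]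

theorem shift_apply (n : Multiplicative ℤ) (f : Multiplicative (ℤ →₀ ZMod 2)) (i : ℤ) :
    (shift n f).toAdd i = f.toAdd (-n.toAdd + i) := by
  simp [shift, AddEquiv.toMultiplicative, Finsupp.equivMapDomain_apply]

theorem Lamplighter.a_zpow (n : ℤ) :
    (a ^ n : Lamplighter) = SemidirectProduct.inr (Multiplicative.ofAdd n) := by
  rw [a, ← map_zpow, ← ofAdd_zsmul]
  simp

theorem Lamplighter.u_zero : u 0 = ε := by simp [u]

/-- The lamps of the elements of the group `⨁ ℤ/2ℤ` generate it. -/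
theorem inl_mem_closure {S : Set ℤ} (f : ℤ →₀ ZMod 2) (hf : ∀ i, f i ≠ 0 → i ∈ S) :
    (SemidirectProduct.inl (Multiplicative.ofAdd f) : Lamplighter) ∈
      Subgroup.closure (u '' S) := by
  induction f using Finsupp.induction with
  | zero => exact Subgroup.one_mem _
  | single_add i c f hi hc ih =>
    rw [ofAdd_add, map_mul]
    refine Subgroup.mul_mem _ (Subgroup.subset_closure ⟨i, hf i ?_, ?_⟩) (ih fun j hj => hf j ?_)
    · simpa [Finsupp.notMem_support_iff.1 hi] using hc
    · have : ∀ c : ZMod 2, c ≠ 0 → c = 1 := by decide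
      rw [u_eq, this c hc]
    · rw [Finsupp.add_apply, Finsupp.single_apply, if_neg, zero_add]
      · exact hj
      · rintro rfl
        exact hj (Finsupp.notMem_support_iff.1 hi)

theorem mem_amalgamatedSubgroup_iff {A : Set ℤ} {x : Lamplighter} :
    x ∈ amalgamatedSubgroup A ↔ x.right = 1 ∧ ∀ i, x.left.toAdd i ≠ 0 → i ∈ A := by
  constructor
  · intro hx
    induction hx using Subgroup.closure_induction with
    | mem x hx =>
      obtain ⟨i, hi, rfl⟩ := hx
      rw [u_eq]
      refine ⟨rfl, fun j hj => ?_⟩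
      by_cases h : i = j
      · exact h ▸ hi
      · simp [h] at hj
    | one => exact ⟨rfl, fun i hi => (hi rfl).elim⟩
    | mul x y _ _ hx hy =>
      refine ⟨by simp [hx.1, hy.1], fun i hi => ?_⟩
      by_cases h : x.left.toAdd i = 0
      · refine hy.2 i fun h' => hi ?_
        simp [hx.1, h, h']
      · exact hx.2 i h
    | inv x _ hx =>
      refine ⟨by simp [hx.1], fun i hi => hx.2 i fun h => hi ?_⟩
      simp [hx.1, h]
  · rintro ⟨h1, h2⟩
    have : x = SemidirectProduct.inl (Multiplicative.ofAdd x.left.toAdd) := by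
      ext1
      · rfl
      · exact h1
    rw [this]
    exact inl_mem_closure _ h2

theorem Lamplighter.closure_a_ε : Subgroup.closure ({a, ε} : Set Lamplighter) = ⊤ := by
  have ha : a ∈ Subgroup.closure ({a, ε} : Set Lamplighter) := Subgroup.subset_closure (by simp)
  have hε : ε ∈ Subgroup.closure ({a, ε} : Set Lamplighter) := Subgroup.subset_closure (by simp)
  refine (Subgroup.eq_top_iff' _).2 fun x => ?_
  rw [← SemidirectProduct.inl_left_mul_inr_right x]
  refine Subgroup.mul_mem _ ?_ ?_
  · have h : Subgroup.closure (u '' Set.univ) ≤ Subgroup.closure ({a, ε} : Set Lamplighter) := by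
      rw [Subgroup.closure_le]
      rintro _ ⟨i, -, rfl⟩
      exact Subgroup.mul_mem _ (Subgroup.mul_mem _ (Subgroup.zpow_mem _ ha i) hε)
        (Subgroup.zpow_mem _ ha _)
    exact h (inl_mem_closure x.left.toAdd fun _ _ => trivial)
  · have := a_zpow x.right.toAdd
    rw [ofAdd_toAdd] at this
    rw [← this]
    exact Subgroup.zpow_mem _ ha _

/-! ### Universal properties of L and of L(A) -/

section Lift

variable {K : Type*} [Group K]

/-- The presentation of the lamplighter group. -/
theorem exists_lamplighter_hom (α e : K) (he : e * e = 1)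
    (hc : ∀ i : ℤ, Commute e (α ^ i * e * α ^ (-i))) :
    ∃ φ : Lamplighter →* K, φ a = α ∧ φ ε = e := by
  let v : ℤ → K := fun i => α ^ i * e * α ^ (-i)
  have hv : ∀ i j, v i * v j = v j * v i := by
    intro i j
    -- Conjugating the relation of index j - i by α ^ i turns it into the commutation of v i and v
    -- j.
    have h := (hc (j - i)).map (MulAut.conj (α ^ i))
    have h1 : (MulAut.conj (α ^ i)) (α ^ (j - i) * e * α ^ (-(j - i))) = v j := by
      simp only [MulAut.conj_apply, v]
      rw [← zpow_neg, ← mul_assoc, ← mul_assoc, ← zpow_add, mul_assoc, ← zpow_add]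
      congr 2
      · congr 1; ring
      · ring
    have h2 : (MulAut.conj (α ^ i)) e = v i := by
      simp only [MulAut.conj_apply, v]
      rw [zpow_neg]
    change Commute ((MulAut.conj (α ^ i)) e) _ at h
    rw [h1, h2] at h
    exact h
  have hv2 : ∀ i, v i * v i = 1 := by
    intro i
    simp only [v]
    rw [show α ^ i * e * α ^ (-i) * (α ^ i * e * α ^ (-i)) =
      α ^ i * (e * (α ^ (-i) * α ^ i) * e) * α ^ (-i) by group, ← zpow_add,
      neg_add_cancel, zpow_zero, mul_one,
      he, mul_one, zpow_neg, mul_inv_cancel]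
  let S : Subgroup K := Subgroup.closure (Set.range v)
  have : IsMulCommutative S := Subgroup.isMulCommutative_closure (by
    rintro _ ⟨i, rfl⟩ _ ⟨j, rfl⟩
    exact hv i j)
  let _ : CommGroup S := { (inferInstance : Group S) with mul_comm := this.is_comm.comm }
  let v' : ℤ → S := fun i => ⟨v i, Subgroup.subset_closure ⟨i, rfl⟩⟩
  have hv' : ∀ i, v' i * v' i = 1 := fun i => Subtype.ext (hv2 i)
  let z : ℤ → (ZMod 2 →+ Additive S) := fun i => ZMod.lift 2
    ⟨zmultiplesHom (Additive S) (Additive.ofMul (v' i)), by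
      have := hv' i
      rw [← pow_two] at this
      change ((2 : ℕ) : ℤ) • Additive.ofMul (v' i) = 0
      rw [natCast_zsmul, ← ofMul_pow, this]
      rfl⟩
  have hz : ∀ i, z i 1 = Additive.ofMul (v' i) := by
    intro i
    have := ZMod.lift_castAddHom 2 (⟨zmultiplesHom (Additive S) (Additive.ofMul (v' i)), by
      have := hv' i
      rw [← pow_two] at this
      change ((2 : ℕ) : ℤ) • Additive.ofMul (v' i) = 0
      rw [natCast_zsmul, ← ofMul_pow, this]
      rfl⟩ :
      {f : ℤ →+ Additive S // f (2 : ℕ) = 0}) 1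
    simpa using this
  let β : Multiplicative (ℤ →₀ ZMod 2) →* S :=
    AddMonoidHom.toMultiplicativeLeft
      (Finsupp.liftAddHom (N := Additive S) z : (ℤ →₀ ZMod 2) →+ Additive S)
  have hβ : ∀ i, β (Multiplicative.ofAdd (Finsupp.single i 1)) = v' i := by
    intro i
    change (Finsupp.liftAddHom z (Finsupp.single i 1)).toMul = _
    rw [Finsupp.liftAddHom_apply_single, hz]
    rfl
  let γ : Multiplicative ℤ →* K := zpowersHom K α
  have hγ : ∀ n : Multiplicative ℤ, γ n = α ^ n.toAdd := fun n => zpowersHom_apply ..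
  refine ⟨SemidirectProduct.lift (S.subtype.comp β) γ ?_, ?_, ?_⟩
  · intro n
    refine MonoidHom.toAdditiveRight.injective ?_
    refine Finsupp.addHom_ext' fun i => ?_
    refine AddMonoidHom.ext fun c => ?_
    have hc01 : c = 0 ∨ c = 1 := by
      revert c; decide
    rcases hc01 with rfl | rfl
    · simp
    · change Additive.ofMul ((β (shift n (Multiplicative.ofAdd (Finsupp.single i 1))) : S) : K) =
        Additive.ofMul (γ n * (β (Multiplicative.ofAdd (Finsupp.single i 1)) : K) * (γ n)⁻¹)
      have hs := shift_ofAdd_single n.toAdd i 1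
      rw [ofAdd_toAdd] at hs
      rw [hs, hβ, hβ, hγ]
      congr 1
      simp only [v', v]
      group
  · rw [a, SemidirectProduct.lift_inr, hγ]
    simp
  · rw [ε, SemidirectProduct.lift_inl, MonoidHom.comp_apply, hβ]
    simp [v', v]

variable {A : Set ℤ}

theorem eqOn_amalgamatedSubgroup {φ₁ φ₂ : Lamplighter →* K} (h : ∀ i ∈ A, φ₁ (u i) = φ₂ (u i)) :
    ∀ x ∈ amalgamatedSubgroup A, φ₁ x = φ₂ x := by
  have : Set.EqOn φ₁ φ₂ (Subgroup.closure (u '' A)) := by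
    refine MonoidHom.eqOn_closure ?_
    rintro _ ⟨i, hi, rfl⟩
    exact h i hi
  exact this

/-- The inclusion of the first factor. -/
noncomputable def inl (A : Set ℤ) : Lamplighter →* DysonGroup A :=
  Monoid.PushoutI.of (φ := fun _ : Fin 2 => (amalgamatedSubgroup A).subtype) 0

/-- The inclusion of the second factor. -/
noncomputable def inr (A : Set ℤ) : Lamplighter →* DysonGroup A :=
  Monoid.PushoutI.of (φ := fun _ : Fin 2 => (amalgamatedSubgroup A).subtype) 1

theorem inl_eq_inr {x : Lamplighter} (hx : x ∈ amalgamatedSubgroup A) : inl A x = inr A x :=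
  (Monoid.PushoutI.of_apply_eq_base (fun _ : Fin 2 => (amalgamatedSubgroup A).subtype) 0
    ⟨x, hx⟩).trans (Monoid.PushoutI.of_apply_eq_base
      (fun _ : Fin 2 => (amalgamatedSubgroup A).subtype) 1 ⟨x, hx⟩).symm

theorem inl_u_eq_inr_u {i : ℤ} (hi : i ∈ A) : inl A (u i) = inr A (u i) :=
  inl_eq_inr (Subgroup.subset_closure ⟨i, hi, rfl⟩)

theorem exists_dysonGroup_hom {φ₁ φ₂ : Lamplighter →* K} (h : ∀ i ∈ A, φ₁ (u i) = φ₂ (u i)) :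
    ∃ φ : DysonGroup A →* K, φ.comp (inl A) = φ₁ ∧ φ.comp (inr A) = φ₂ := by
  refine ⟨Monoid.PushoutI.lift (fun i : Fin 2 => if i = 0 then φ₁ else φ₂)
    (φ₁.comp (amalgamatedSubgroup A).subtype) ?_, ?_, ?_⟩
  · intro i
    ext x
    by_cases hi : i = 0
    · simp [hi]
    · simpa [hi] using (eqOn_amalgamatedSubgroup h x.1 x.2).symm
  · ext1 x
    simp [inl, Monoid.PushoutI.lift_of]
  · ext1 x
    simp [inr, Monoid.PushoutI.lift_of]

/-- The projection of the free product to the amalgamated product. -/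
noncomputable def proj (A : Set ℤ) : Monoid.Coprod Lamplighter Lamplighter →* DysonGroup A :=
  Monoid.Coprod.lift (inl A) (inr A)

theorem proj_surjective (A : Set ℤ) : Function.Surjective (proj A) := by
  intro x
  induction x using Monoid.PushoutI.induction_on with
  | of i x =>
    fin_cases i
    · exact ⟨Monoid.Coprod.inl x, by simp [proj, inl]⟩
    · exact ⟨Monoid.Coprod.inr x, by simp [proj, inr]⟩
  | base x =>
    refine ⟨Monoid.Coprod.inl x.1, ?_⟩
    rw [proj, Monoid.Coprod.lift_apply_inl]
    exact Monoid.PushoutI.of_apply_eq_base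
      (fun _ : Fin 2 => (amalgamatedSubgroup A).subtype) 0 x
  | mul x y hx hy =>
    obtain ⟨x, rfl⟩ := hx
    obtain ⟨y, rfl⟩ := hy
    exact ⟨x * y, map_mul _ _ _⟩

end Lift

/-- Labelling symbols by their cosets gives a wreath representation that is well defined on L(A) and
detects the trace; conversely a trivial trace kills w under any two morphisms that agree on U, in
particular the two inclusions. -/
theorem proj_eq_one_iff {A : Set ℤ} {w : Monoid.Coprod Lamplighter Lamplighter} :
    proj A w = 1 ↔ Doubling.IsTrivialOver (amalgamatedSubgroup A) w := by
  constructor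
  · intro h
    apply Doubling.isTrivialOver_of_wreathConj
    set Ψ := Doubling.wreathConj (MonoidHom.id Lamplighter)
      (fun x => FreeGroup.of (QuotientGroup.mk (s := amalgamatedSubgroup A) x)) with hΨ
    obtain ⟨φ, h1, h2⟩ := exists_dysonGroup_hom (A := A) (φ₁ := Ψ.comp Monoid.Coprod.inl)
      (φ₂ := Ψ.comp Monoid.Coprod.inr) (by
        intro i hi
        refine Doubling.wreathConj_inl_eq_inr (MonoidHom.id Lamplighter)
          (fun x => FreeGroup.of (QuotientGroup.mk (s := amalgamatedSubgroup A) x)) fun y => ?_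
        congr 1
        exact QuotientGroup.eq.2 (by
          rw [MonoidHom.id_apply, mul_inv_rev, inv_mul_cancel_right]
          exact Subgroup.inv_mem _ (Subgroup.subset_closure (Set.mem_image_of_mem u hi))))
    have h3 : φ.comp (proj A) = Ψ := by
      refine Monoid.Coprod.hom_ext ?_ ?_
      · rw [← h1, proj, MonoidHom.comp_assoc, Monoid.Coprod.lift_comp_inl]
      · rw [← h2, proj, MonoidHom.comp_assoc, Monoid.Coprod.lift_comp_inr]
    rw [← h3, MonoidHom.comp_apply, h, map_one]
  · intro h
    exact h.lift_eq_one fun x hx => inl_eq_inr hx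

/-- The quotient of the two copies of u_i has trace [1][u_i]⁻¹, which vanishes only if u_i ∈ U; and
the lamps of elements of U lie in A. -/
theorem inl_u_eq_inr_u_iff {A : Set ℤ} {i : ℤ} : inl A (u i) = inr A (u i) ↔ i ∈ A := by
  refine ⟨fun h => ?_, inl_u_eq_inr_u⟩
  have h1 : proj A (Monoid.Coprod.inr (u i) * (Monoid.Coprod.inl (u i))⁻¹) = 1 := by
    simp [proj, h]
  have h2 := (proj_eq_one_iff.1 h1).2
  rw [← map_inv, Doubling.trace_mul, Doubling.trace_inr, Doubling.trace_inl] at h2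
  simp only [inv_one, one_mul, mul_one, map_mul, map_inv, FreeGroup.map.of] at h2
  have h3 := FreeGroup.of_injective (mul_inv_eq_one.1 h2)
  have h4 := (mem_amalgamatedSubgroup_iff.1 (QuotientGroup.eq.1 h3)).2 i
  refine h4 ?_
  simp [u_eq]

end Dyson

/-! ### Free groups are residually finite -/

theorem Equiv.Perm.exists_extending_relation {α : Type*} [Finite α] {R : α → α → Prop}
    (h₁ : ∀ p q q', R p q → R p q' → q = q') (h₂ : ∀ p p' q, R p q → R p' q → p = p') :
    ∃ σ : Equiv.Perm α, ∀ p q, R p q → σ p = q := by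
  classical
  have := Fintype.ofFinite α
  let f : α → α := fun p => if h : ∃ q, R p q then h.choose else p
  have hf : ∀ p q, R p q → f p = q := by
    intro p q h
    have h' : ∃ q, R p q := ⟨q, h⟩
    simp only [f, dif_pos h']
    exact h₁ p _ _ h'.choose_spec h
  obtain ⟨g, hg⟩ := Set.MapsTo.exists_equiv_extend_of_card_eq (t := (Finset.univ : Finset α))
    (s := {p | ∃ q, R p q}) (f := f) (by simp) (fun _ _ => by simp) (by
      rintro p ⟨q, hq⟩ p' ⟨q', hq'⟩ h
      rw [hf p q hq, hf p' q' hq'] at h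
      exact h₂ p p' q hq (h ▸ hq'))
  refine ⟨g.trans (Equiv.subtypeUnivEquiv (by simp)), fun p q h => ?_⟩
  rw [Equiv.trans_apply, Equiv.subtypeUnivEquiv_apply, hg p ⟨q, h⟩, hf p q h]

/-- The reduced word is laid out as a path through the points 0, …, length. Each generator
prescribes a partial injection along the path, by reducedness, and extends to a permutation; the
word then sends the last point to 0. -/
theorem FreeGroup.exists_perm_lift_ne_one {X : Type*} {x : FreeGroup X} (hx : x ≠ 1) :
    ∃ (m : ℕ) (σ : X → Equiv.Perm (Fin m)), FreeGroup.lift σ x ≠ 1 := by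
  classical
  set l := x.toWord with hl
  have hred : FreeGroup.IsReduced l := FreeGroup.isReduced_toWord
  have hchain : ∀ j (h : j + 1 < l.length), l[j].1 = l[j + 1].1 → l[j].2 = l[j + 1].2 :=
    List.isChain_iff_getElem.1 hred
  -- The rightmost letter acts first, so the letter of index j leads from j + 1 to j; an inverse
  -- letter prescribes the reverse arrow for its generator.
  let R : X → Fin (l.length + 1) → Fin (l.length + 1) → Prop := fun x p q =>
    ∃ (j : ℕ) (h : j < l.length), (l[j] = (x, true) ∧ p.1 = j + 1 ∧ q.1 = j) ∨
      (l[j] = (x, false) ∧ p.1 = j ∧ q.1 = j + 1)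
  have hσ : ∀ x, ∃ σ : Equiv.Perm (Fin (l.length + 1)), ∀ p q, R x p q → σ p = q := by
    intro x
    apply Equiv.Perm.exists_extending_relation
    · rintro p q q' ⟨j, h, ⟨e, h1, h2⟩ | ⟨e, h1, h2⟩⟩ ⟨j', h', ⟨e', h1', h2'⟩ | ⟨e', h1', h2'⟩⟩
      · ext; omega
      · obtain rfl : j' = j + 1 := by omega
        have := hchain j h'
        simp [e, e'] at this
      · obtain rfl : j = j' + 1 := by omega
        have := hchain j' h
        simp [e, e'] at this
      · ext; omega
    · rintro p p' q ⟨j, h, ⟨e, h1, h2⟩ | ⟨e, h1, h2⟩⟩ ⟨j', h', ⟨e', h1', h2'⟩ | ⟨e', h1', h2'⟩⟩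
      · ext; omega
      · obtain rfl : j = j' + 1 := by omega
        have := hchain j' h
        simp [e, e'] at this
      · obtain rfl : j' = j + 1 := by omega
        have := hchain j h'
        simp [e, e'] at this
      · ext; omega
  choose σ hσ using hσ
  refine ⟨_, σ, fun h1 => hx ?_⟩
  -- Applying the last d letters has moved the last point d places down.
  have key : ∀ d, d ≤ l.length →
      FreeGroup.lift σ (FreeGroup.mk (l.drop (l.length - d))) (Fin.last _) =
        Fin.ofNat _ (l.length - d) := by
    intro d
    induction d with
    | zero =>
      intro _
      ext
      simp
    | succ d ih =>
      intro hd
      have hlt : l.length - (d + 1) < l.length := by omega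
      rw [List.drop_eq_getElem_cons hlt, show l.length - (d + 1) + 1 = l.length - d by omega,
        ← List.singleton_append, ← FreeGroup.mul_mk, _root_.map_mul,
        Equiv.Perm.mul_apply, ih (by omega)]
      have hv : ∀ i, i ≤ l.length → ((Fin.ofNat (l.length + 1) i : Fin _) : ℕ) = i := fun i hi =>
        Nat.mod_eq_of_lt (by omega)
      rcases he : l[l.length - (d + 1)] with ⟨y, b⟩
      cases b
      · have := hσ y (Fin.ofNat _ (l.length - (d + 1))) (Fin.ofNat _ (l.length - d))
          ⟨_, hlt, Or.inr ⟨he, hv _ (by omega), by rw [hv _ (by omega)]; omega⟩⟩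
        rw [← this]
        simp
      · have := hσ y (Fin.ofNat _ (l.length - d)) (Fin.ofNat _ (l.length - (d + 1)))
          ⟨_, hlt, Or.inl ⟨he, by rw [hv _ (by omega)]; omega, hv _ (by omega)⟩⟩
        rw [← this]
        simp
  have h2 := key l.length le_rfl
  have hmk : FreeGroup.mk l = x := FreeGroup.mk_toWord
  rw [Nat.sub_self, List.drop_zero, hmk, h1] at h2
  have h3 := congrArg Fin.val h2
  simp at h3
  exact FreeGroup.toWord_eq_nil_iff.1 h3

/-! ### Finite quotients of the amalgams of lamplighter groups -/

namespace Dyson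

open Lamplighter

/-- The reduction of the indices modulo `p`. -/
noncomputable def Lamplighter.reduceMod (p : ℕ) : Lamplighter →*
    RegularWreathProduct (Multiplicative (ZMod 2)) (Multiplicative (ZMod p)) where
  toFun x := ⟨fun c => Multiplicative.ofAdd
    (Finsupp.mapDomain (Int.cast : ℤ → ZMod p) x.left.toAdd c.toAdd),
    Multiplicative.ofAdd (x.right.toAdd : ZMod p)⟩
  map_one' := by
    ext1
    · ext c
      simp
    · simp
  map_mul' x y := by
    ext1
    · funext c
      refine Multiplicative.toAdd.injective ?_
      have h : Finsupp.mapDomain (Int.cast : ℤ → ZMod p) (shift x.right y.left).toAdd c.toAdd =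
          Finsupp.mapDomain (Int.cast : ℤ → ZMod p) y.left.toAdd
            (-(x.right.toAdd : ZMod p) + c.toAdd) := by
        have h1 : (shift x.right y.left).toAdd =
            Finsupp.mapDomain (fun i => x.right.toAdd + i) y.left.toAdd :=
          Finsupp.equivMapDomain_eq_mapDomain (Equiv.addLeft x.right.toAdd) y.left.toAdd
        have h2 : (Int.cast : ℤ → ZMod p) ∘ (fun i => x.right.toAdd + i) =
            (fun c => (x.right.toAdd : ZMod p) + c) ∘ Int.cast := by
          ext i
          simp
        rw [h1, ← Finsupp.mapDomain_comp, h2, Finsupp.mapDomain_comp]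
        conv_lhs => rw [← add_neg_cancel_left (x.right.toAdd : ZMod p) c.toAdd]
        exact Finsupp.mapDomain_apply (add_right_injective _) _ _
      simp [Finsupp.mapDomain_add, h]
    · simp

theorem Lamplighter.reduceMod_left (p : ℕ) (x : Lamplighter) (c : Multiplicative (ZMod p)) :
    (reduceMod p x).left c = Multiplicative.ofAdd
      (Finsupp.mapDomain (Int.cast : ℤ → ZMod p) x.left.toAdd c.toAdd) := rfl

theorem Lamplighter.reduceMod_right (p : ℕ) (x : Lamplighter) :
    (reduceMod p x).right = Multiplicative.ofAdd (x.right.toAdd : ZMod p) := rfl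

/-- The elements of the lamplighter group with support and position bounded by `k`. -/
def box (k : ℕ) : Set Lamplighter :=
  {x | |x.right.toAdd| ≤ k ∧ ∀ i, x.left.toAdd i ≠ 0 → |i| ≤ k}

theorem one_mem_box (k : ℕ) : 1 ∈ box k := ⟨by simp, fun i hi => (hi rfl).elim⟩

theorem box_mono {k l : ℕ} (h : k ≤ l) : box k ⊆ box l := by
  have : (k : ℤ) ≤ l := by exact_mod_cast h
  exact fun x hx => ⟨hx.1.trans this, fun i hi => (hx.2 i hi).trans this⟩

/-- Dividing by x shifts the indices by the position of x, which is itself at most k; hence the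
factor 2. -/
theorem inv_mul_mem_box {k : ℕ} {x y : Lamplighter} (hx : x ∈ box k) (hy : y ∈ box k) :
    x⁻¹ * y ∈ box (2 * k) := by
  have h1 := abs_le.1 hx.1
  have h2 := abs_le.1 hy.1
  constructor
  · rw [SemidirectProduct.mul_right, SemidirectProduct.inv_right, toAdd_mul, toAdd_inv, abs_le]
    push_cast
    constructor <;> linarith
  · intro i hi
    have h3 : x.left.toAdd (x.right.toAdd + i) ≠ 0 ∨ y.left.toAdd (x.right.toAdd + i) ≠ 0 := by
      by_contra! h
      refine hi ?_
      rw [SemidirectProduct.mul_left, SemidirectProduct.inv_left, SemidirectProduct.inv_right,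
        toAdd_mul, Finsupp.add_apply, shift_apply, shift_apply]
      simp [h]
    rw [abs_le]
    push_cast
    rcases h3 with h3 | h3
    · have := abs_le.1 (hx.2 _ h3)
      constructor <;> linarith
    · have := abs_le.1 (hy.2 _ h3)
      constructor <;> linarith

theorem Lamplighter.eq_of_intCast_eq {p k : ℕ} (hp : 2 * k < p) {i j : ℤ} (hi : |i| ≤ k)
    (hj : |j| ≤ k) (h : (i : ZMod p) = j) : i = j := by
  have h1 := (ZMod.intCast_eq_intCast_iff_dvd_sub i j p).1 h
  have hi := abs_le.1 hi
  have hj := abs_le.1 hj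
  have : j - i = 0 := Int.eq_zero_of_abs_lt_dvd h1 (by rw [abs_lt]; constructor <;> omega)
  omega

/-- As p > 2k, distinct indices of the window have distinct residues, so no two lamps of x
interfere. -/
theorem Lamplighter.reduceMod_left_intCast {p k : ℕ} (hp : 2 * k < p) {x : Lamplighter}
    (hx : x ∈ box k) {i : ℤ} (hi : |i| ≤ k) :
    (reduceMod p x).left (Multiplicative.ofAdd (i : ZMod p)) =
      Multiplicative.ofAdd (x.left.toAdd i) := by
  rw [reduceMod_left, toAdd_ofAdd, Finsupp.mapDomain_apply' {i : ℤ | |i| ≤ k}]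
  · intro j hj
    exact hx.2 j (Finsupp.mem_support_iff.1 hj)
  · intro i hi j hj h
    exact eq_of_intCast_eq hp hi hj h
  · exact hi

theorem Lamplighter.eq_one_of_reduceMod_eq_one {p k : ℕ} (hp : 2 * k < p) {x : Lamplighter}
    (hx : x ∈ box k) (h : reduceMod p x = 1) : x = 1 := by
  ext1
  · refine Multiplicative.toAdd.injective (Finsupp.ext fun i => ?_)
    by_contra hi
    have h1 := reduceMod_left_intCast hp hx (hx.2 i hi)
    rw [h] at h1
    exact hi (congrArg Multiplicative.toAdd h1).symm
  · have h1 := reduceMod_right p x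
    rw [h] at h1
    have h2 : ((x.right.toAdd : ℤ) : ZMod p) = (0 : ℤ) := by
      simpa using (congrArg Multiplicative.toAdd h1).symm
    exact congrArg Multiplicative.ofAdd (eq_of_intCast_eq hp hx.1 (by simp) h2)

theorem Lamplighter.reduceMod_u (p : ℕ) (i : ℤ) (c : Multiplicative (ZMod p))
    (h : (i : ZMod p) ≠ c.toAdd) : (reduceMod p (u i)).left c = 1 := by
  rw [reduceMod_left, u_eq]
  simp [Finsupp.mapDomain_single, h]

/-- The elements of the finite lamplighter group that are supported outside `S`. -/
def supportedOff {p : ℕ} (S : Set (ZMod p)) : Subgroup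
    (RegularWreathProduct (Multiplicative (ZMod 2)) (Multiplicative (ZMod p))) where
  carrier := {x | x.right = 1 ∧ ∀ c, c.toAdd ∈ S → x.left c = 1}
  one_mem' := ⟨rfl, fun _ _ => rfl⟩
  mul_mem' := by
    rintro x y ⟨hx, hx'⟩ ⟨hy, hy'⟩
    exact ⟨by simp [hx, hy], fun c hc => by simp [hx, hx' c hc, hy' c hc]⟩
  inv_mem' := by
    rintro x ⟨hx, hx'⟩
    exact ⟨by simp [hx], fun c hc => by simp [hx, hx' c hc]⟩

/-- The finite analogue of U is `supportedOff S`, where S holds the residues of the progressions n +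
(q n)ℤ. Two letters of the trace whose reductions are congruent modulo it were already congruent
modulo U, since S contains every index of the window outside A. So the trace remains non-trivial
over finitely many cosets, and permutations detect it. The modulus q is left free because different
applications need different choices. -/
theorem exists_finite_separating {A : Set ℤ} {k : ℕ} {w : Monoid.Coprod Lamplighter Lamplighter}
    (h₁ : Doubling.fold w ∈ box k)
    (h₂ : Doubling.trace w 1 ∈ Subgroup.closure (FreeGroup.of '' box k))
    (hw : proj A w ≠ 1) {q : ℤ → ℤ} (hq : ∀ n, q n ≠ 0) :
    ∃ (F : Type) (_ : Group F) (_ : Finite F) (φ₁ φ₂ : Lamplighter →* F),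
      Monoid.Coprod.lift φ₁ φ₂ w ≠ 1 ∧
        ∀ i, φ₁ (u i) = φ₂ (u i) ∨ ∃ n, n ∉ A ∧ |n| ≤ (2 * k : ℕ) ∧ q n ∣ i - n := by
  -- The product makes p a multiple of each q n in the window, so that the progressions are unions
  -- of classes modulo p; the factor 4k + 1 makes reduction injective on indices bounded by 2k.
  obtain ⟨p, hp0, hp, hpq⟩ : ∃ p : ℕ, p ≠ 0 ∧ 2 * (2 * k) < p ∧
      ∀ n : ℤ, |n| ≤ (2 * k : ℕ) → q n ∣ p := by
    refine ⟨(∏ n ∈ Finset.Icc (-(2 * k : ℕ) : ℤ) (2 * k : ℕ), (q n).natAbs) * (4 * k + 1),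
      ?_, ?_, ?_⟩
    · refine mul_ne_zero (Finset.prod_ne_zero_iff.2 fun n _ => ?_) (by omega)
      simpa using hq n
    · have : 0 < ∏ n ∈ Finset.Icc (-(2 * k : ℕ) : ℤ) (2 * k : ℕ), (q n).natAbs :=
        Finset.prod_pos fun n _ => Int.natAbs_pos.2 (hq n)
      nlinarith
    · intro n hn
      rw [← Int.natAbs_dvd, Int.natCast_dvd_natCast]
      exact Dvd.dvd.mul_right (Finset.dvd_prod_of_mem _ (Finset.mem_Icc.2 (abs_le.1 hn))) _
  have : NeZero p := ⟨hp0⟩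
  rw [Ne, proj_eq_one_iff] at hw
  by_cases hfold : Doubling.fold w = 1
  swap
  -- If the folded element is already non-trivial, the same reduction on both copies detects it.
  · refine ⟨_, _, inferInstance, reduceMod p, reduceMod p, ?_, fun i => Or.inl rfl⟩
    have : Monoid.Coprod.lift (reduceMod p) (reduceMod p) = (reduceMod p).comp Doubling.fold :=
      Monoid.Coprod.hom_ext (by ext1; simp [Doubling.fold]) (by ext1; simp [Doubling.fold])
    rw [this]
    exact fun h => hfold (eq_one_of_reduceMod_eq_one (k := k) (by omega) h₁ h)
  let S : Set (ZMod p) :=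
    {c | ∃ i n : ℤ, n ∉ A ∧ |n| ≤ (2 * k : ℕ) ∧ q n ∣ i - n ∧ (i : ZMod p) = c}
  have htr : FreeGroup.map (fun x => QuotientGroup.mk (s := supportedOff S) (reduceMod p x))
      (Doubling.trace w 1) ≠ 1 := by
    refine fun h => hw ⟨hfold, FreeGroup.map_eq_one_of_map_eq_one h₂ ?_ h⟩
    intro v hv v' hv' e
    have hbox := inv_mul_mem_box hv hv'
    have hmem := QuotientGroup.eq.1 e
    rw [← map_inv, ← map_mul] at hmem
    refine QuotientGroup.eq.2 (mem_amalgamatedSubgroup_iff.2 ⟨?_, fun i hi => ?_⟩)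
    · have h1 := hmem.1
      rw [reduceMod_right] at h1
      exact congrArg Multiplicative.ofAdd (eq_of_intCast_eq hp hbox.1 (j := 0) (by simp)
        (by simpa using congrArg Multiplicative.toAdd h1))
    · by_contra hiA
      have hik := hbox.2 i hi
      have h1 := hmem.2 (Multiplicative.ofAdd (i : ZMod p)) ⟨i, i, hiA, hik, by simp, rfl⟩
      rw [reduceMod_left_intCast hp hbox hik] at h1
      exact hi (congrArg Multiplicative.toAdd h1)
  obtain ⟨m, σ, hσ⟩ := FreeGroup.exists_perm_lift_ne_one htr
  let Ψ := Doubling.wreathConj (reduceMod p)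
    (fun x => σ (QuotientGroup.mk (s := supportedOff S) x))
  refine ⟨_, _, inferInstance, Ψ.comp Monoid.Coprod.inl, Ψ.comp Monoid.Coprod.inr, ?_, fun i => ?_⟩
  · have h3 : Monoid.Coprod.lift (Ψ.comp Monoid.Coprod.inl) (Ψ.comp Monoid.Coprod.inr) = Ψ :=
      Monoid.Coprod.hom_ext (by ext1; simp) (by ext1; simp)
    rw [h3]
    intro h
    have h4 := Doubling.wreathConj_left (reduceMod p)
      (fun x => σ (QuotientGroup.mk (s := supportedOff S) x)) w 1
    change (Ψ w).left _ = _ at h4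
    rw [h] at h4
    refine hσ ?_
    have h5 : (FreeGroup.lift σ).comp (FreeGroup.map fun x =>
        QuotientGroup.mk (s := supportedOff S) (reduceMod p x)) =
        FreeGroup.lift ((fun x => σ (QuotientGroup.mk (s := supportedOff S) x)) ∘ reduceMod p) :=
      FreeGroup.ext_hom _ _ (by simp)
    exact (DFunLike.congr_fun h5 _).trans h4.symm
  · by_cases hi : ∃ n, n ∉ A ∧ |n| ≤ (2 * k : ℕ) ∧ q n ∣ i - n
    · exact Or.inr hi
    · left
      refine Doubling.wreathConj_inl_eq_inr (reduceMod p)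
        (fun x => σ (QuotientGroup.mk (s := supportedOff S) x)) fun y =>
          congrArg σ (QuotientGroup.eq.2 ?_)
      rw [mul_inv_rev, inv_mul_cancel_right]
      refine Subgroup.inv_mem _ ⟨?_, fun c hc => reduceMod_u p i c fun hic => hi ?_⟩
      · rw [reduceMod_right, u_eq]
        simp
      · obtain ⟨j, n, hnA, hn, hj, hjc⟩ := hc
        refine ⟨n, hnA, hn, ?_⟩
        -- S only knows some j ≡ i mod p in the progression; as q n divides p, i belongs to it too.
        have h5 := (ZMod.intCast_eq_intCast_iff_dvd_sub i j p).1 (hic.trans hjc.symm)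
        have h6 := dvd_sub hj ((hpq n hn).trans h5)
        rwa [show j - n - (j - i) = i - n by ring] at h6

end Dyson

/-! ### Words on the standard generators and the region that they explore -/

namespace Dyson

open Lamplighter

section Words

variable {K : Type*} [Group K]

/-- The images of the standard generators of the two copies of the lamplighter group. -/
noncomputable def pairGen (φ₁ φ₂ : Lamplighter →* K) : Fin 4 → K := ![φ₁ a, φ₁ ε, φ₂ a, φ₂ ε]

/-- The standard generators of `L(A)`. -/
noncomputable def stdGen (A : Set ℤ) : Fin 4 → DysonGroup A := pairGen (inl A) (inr A)

/-- The element of the free product represented by a word on the standard generators. -/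
noncomputable def freeValue (w : GroupWord 4) : Monoid.Coprod Lamplighter Lamplighter :=
  wordValue (pairGen Monoid.Coprod.inl Monoid.Coprod.inr) w

theorem map_pairGen {H : Type*} [Group H] (ψ : K →* H) (φ₁ φ₂ : Lamplighter →* K) :
    (fun k => ψ (pairGen φ₁ φ₂ k)) = pairGen (ψ.comp φ₁) (ψ.comp φ₂) := by
  funext k
  fin_cases k <;> rfl

theorem lift_freeValue (φ₁ φ₂ : Lamplighter →* K) (w : GroupWord 4) :
    Monoid.Coprod.lift φ₁ φ₂ (freeValue w) = wordValue (pairGen φ₁ φ₂) w := by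
  rw [freeValue, map_wordValue, map_pairGen, Monoid.Coprod.lift_comp_inl,
    Monoid.Coprod.lift_comp_inr]

theorem proj_freeValue (A : Set ℤ) (w : GroupWord 4) :
    proj A (freeValue w) = wordValue (stdGen A) w :=
  lift_freeValue _ _ w

theorem generates_stdGen (A : Set ℤ) : Generates (stdGen A) := by
  have h : ∀ (φ : Lamplighter →* DysonGroup A) (S : Subgroup (DysonGroup A)), φ a ∈ S → φ ε ∈ S →
      ∀ x, φ x ∈ S := by
    intro φ S ha hε x
    have hle : Subgroup.closure {a, ε} ≤ S.comap φ := by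
      rw [Subgroup.closure_le]
      rintro y (rfl | rfl)
      exacts [ha, hε]
    exact hle (closure_a_ε ▸ Subgroup.mem_top x)
  have hk : ∀ k, stdGen A k ∈ Subgroup.closure (Set.range (stdGen A)) := fun k =>
    Subgroup.subset_closure ⟨k, rfl⟩
  refine (Subgroup.eq_top_iff' _).2 fun x => ?_
  obtain ⟨w, rfl⟩ := proj_surjective A x
  induction w using Monoid.Coprod.induction_on with
  | inl x => exact h (inl A) _ (hk 0) (hk 1) x
  | inr x => exact h (inr A) _ (hk 2) (hk 3) x
  | mul x y hx hy =>
    rw [map_mul]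
    exact Subgroup.mul_mem _ hx hy

theorem mul_a_zpow_mem_box {j : ℕ} {x : Lamplighter} (hx : x ∈ box j) {n : ℤ} (hn : |n| ≤ 1) :
    x * a ^ n ∈ box (j + 1) := by
  rw [a_zpow]
  have h1 := abs_le.1 hx.1
  have h2 := abs_le.1 hn
  refine ⟨?_, fun i hi => ?_⟩
  · rw [SemidirectProduct.mul_right, SemidirectProduct.right_inr, toAdd_mul, toAdd_ofAdd, abs_le]
    push_cast
    constructor <;> linarith
  · rw [SemidirectProduct.mul_left, SemidirectProduct.left_inr, map_one, mul_one] at hi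
    push_cast
    linarith [hx.2 i hi]

theorem mul_ε_mem_box {j : ℕ} {x : Lamplighter} (hx : x ∈ box j) : x * ε ∈ box (j + 1) := by
  have h1 := hx.1
  refine ⟨?_, fun i hi => ?_⟩
  · rw [SemidirectProduct.mul_right, ε, SemidirectProduct.right_inl, mul_one]
    push_cast
    linarith
  · push_cast
    rw [SemidirectProduct.mul_left, ε, SemidirectProduct.left_inl, toAdd_mul,
      Finsupp.add_apply] at hi
    by_cases h : x.left.toAdd i = 0
    · rw [h, zero_add] at hi
      have h2 := shift_ofAdd_single x.right.toAdd 0 1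
      rw [ofAdd_toAdd] at h2
      rw [h2, toAdd_ofAdd, Finsupp.single_apply] at hi
      have : x.right.toAdd = i := by
        by_contra h3
        simp [h3] at hi
      rw [← this]
      linarith
    · linarith [hx.2 i h]

theorem ε_inv : (ε : Lamplighter)⁻¹ = ε := by
  rw [inv_eq_iff_mul_eq_one, ε, ← map_mul, ← ofAdd_add, ← Finsupp.single_add]
  have : (1 + 1 : ZMod 2) = 0 := by decide
  simp [this]

/-- Each letter moves the position by at most one or switches the lamp at the current position, so
the radius grows by at most one. The starting point y⁻¹ is arbitrary because the induction removes
the first letter. -/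
theorem freeValue_mem_box (w : GroupWord 4) (j : ℕ) (y : Lamplighter) (hy : y⁻¹ ∈ box j) :
    Doubling.trace (freeValue w) y ∈ Subgroup.closure (FreeGroup.of '' box (j + w.length)) ∧
      y⁻¹ * Doubling.fold (freeValue w) ∈ box (j + w.length) := by
  induction w generalizing j y with
  | nil => simpa [freeValue, Doubling.trace] using hy
  | cons x w ih =>
    have key : ∀ v : Lamplighter, y⁻¹ * v ∈ box (j + 1) → ∀ z, z = Monoid.Coprod.inl v ∨
        z = Monoid.Coprod.inr v →
        Doubling.trace (z * freeValue w) y ∈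
          Subgroup.closure (FreeGroup.of '' box (j + (w.length + 1))) ∧
        y⁻¹ * Doubling.fold (z * freeValue w) ∈ box (j + (w.length + 1)) := by
      intro v hv z hz
      have hfold : Doubling.fold z = v := by
        rcases hz with rfl | rfl <;> simp [Doubling.fold]
      have h1 := ih (j + 1) (v⁻¹ * y) (by simpa using hv)
      rw [show j + 1 + w.length = j + (w.length + 1) by omega, mul_inv_rev, inv_inv] at h1
      rw [Doubling.trace_mul, map_mul, hfold, ← mul_assoc]
      refine ⟨Subgroup.mul_mem _ ?_ h1.1, h1.2⟩
      rcases hz with rfl | rfl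
      · rw [Doubling.trace_inl]
        exact Subgroup.one_mem _
      · rw [Doubling.trace_inr]
        exact Subgroup.mul_mem _ (Subgroup.subset_closure ⟨_, box_mono (by omega) hy, rfl⟩)
          (Subgroup.inv_mem _ (Subgroup.subset_closure ⟨_, box_mono (by omega) hv, rfl⟩))
    have ha : y⁻¹ * a ∈ box (j + 1) := by
      simpa using mul_a_zpow_mem_box hy (n := 1) (by simp)
    have ha' : y⁻¹ * a⁻¹ ∈ box (j + 1) := by
      simpa using mul_a_zpow_mem_box hy (n := -1) (by simp)
    have hε : y⁻¹ * ε ∈ box (j + 1) := mul_ε_mem_box hy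
    have hε' : y⁻¹ * ε⁻¹ ∈ box (j + 1) := by
      rw [ε_inv]
      exact hε
    rw [List.length_cons, freeValue, wordValue_cons]
    obtain ⟨k, b⟩ := x
    fin_cases k <;> cases b
    · exact key _ ha' _ (Or.inl (map_inv _ _).symm)
    · exact key _ ha _ (Or.inl rfl)
    · exact key _ hε' _ (Or.inl (map_inv _ _).symm)
    · exact key _ hε _ (Or.inl rfl)
    · exact key _ ha' _ (Or.inr (map_inv _ _).symm)
    · exact key _ ha _ (Or.inr rfl)
    · exact key _ hε' _ (Or.inr (map_inv _ _).symm)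
    · exact key _ hε _ (Or.inr rfl)

theorem trace_freeValue_mem (w : GroupWord 4) :
    Doubling.trace (freeValue w) 1 ∈ Subgroup.closure (FreeGroup.of '' box w.length) := by
  simpa using (freeValue_mem_box w 0 1 (by simpa using one_mem_box 0)).1

theorem fold_freeValue_mem (w : GroupWord 4) : Doubling.fold (freeValue w) ∈ box w.length := by
  simpa using (freeValue_mem_box w 0 1 (by simpa using one_mem_box 0)).2

/-- Only the identifications of bounded index matter for a given word. -/
theorem wordValue_pairGen_eq_one {A : Set ℤ} {w : GroupWord 4} (hw : wordValue (stdGen A) w = 1)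
    {φ₁ φ₂ : Lamplighter →* K}
    (h : ∀ i ∈ A, |i| ≤ (2 * w.length : ℕ) → φ₁ (u i) = φ₂ (u i)) :
    wordValue (pairGen φ₁ φ₂) w = 1 := by
  rw [← proj_freeValue, proj_eq_one_iff] at hw
  have h1 : Doubling.IsTrivialOver (amalgamatedSubgroup (A ∩ {i | |i| ≤ (2 * w.length : ℕ)}))
      (freeValue w) := by
    refine hw.mono (trace_freeValue_mem w) fun v hv v' hv' hm => ?_
    rw [mem_amalgamatedSubgroup_iff] at hm ⊢
    exact ⟨hm.1, fun i hi => ⟨hm.2 i hi, (inv_mul_mem_box hv hv').2 i hi⟩⟩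
  rw [← lift_freeValue]
  exact h1.lift_eq_one (eqOn_amalgamatedSubgroup fun i hi => h i hi.1 hi.2)

/-- Words representing non-trivial elements survive in a finite quotient. -/
theorem exists_finite_separating_word {A : Set ℤ} {w : GroupWord 4}
    (hw : wordValue (stdGen A) w ≠ 1) {q : ℤ → ℤ} (hq : ∀ n, q n ≠ 0) :
    ∃ (F : Type) (_ : Group F) (_ : Finite F) (φ₁ φ₂ : Lamplighter →* F),
      wordValue (pairGen φ₁ φ₂) w ≠ 1 ∧
        ∀ i, φ₁ (u i) = φ₂ (u i) ∨ ∃ n, n ∉ A ∧ |n| ≤ (2 * w.length : ℕ) ∧ q n ∣ i - n := by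
  rw [← proj_freeValue] at hw
  obtain ⟨F, _, _, φ₁, φ₂, h1, h2⟩ := exists_finite_separating (fold_freeValue_mem w)
    (trace_freeValue_mem w) hw hq
  refine ⟨F, _, inferInstance, φ₁, φ₂, ?_, h2⟩
  rwa [← lift_freeValue]

end Words

/-! ### The standard presentation, and translation of indices into words -/

section Presentation

/-- The square of a letter. -/
def squareWord (e : Fin 4) : GroupWord 4 := [(e, true), (e, true)]

/-- The commutator of the letter `e` with its conjugate by the `i`-th power of the letter `a`. -/
def commutatorWord (a e : Fin 4) (i : ℤ) : GroupWord 4 :=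
  [(e, true)] ++ wordConj [(a, true)] [(e, true)] i ++
    FreeGroup.invRev (wordConj [(a, true)] [(e, true)] i ++ [(e, true)])

/-- The relator that identifies the copies of `u i`. -/
def identificationWord (i : ℤ) : GroupWord 4 :=
  wordConj [(0, true)] [(1, true)] i ++ FreeGroup.invRev (wordConj [(2, true)] [(3, true)] i)

variable {K : Type*} [Group K]

theorem wordValue_squareWord (x : Fin 4 → K) (e : Fin 4) :
    wordValue x (squareWord e) = x e * x e := by
  simp [squareWord, wordValue_cons]

theorem wordValue_commutatorWord_eq_one_iff (x : Fin 4 → K) (a e : Fin 4) (i : ℤ) :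
    wordValue x (commutatorWord a e i) = 1 ↔ Commute (x e) (x a ^ i * x e * x a ^ (-i)) := by
  rw [commutatorWord, wordValue_append, wordValue_invRev, mul_inv_eq_one, wordValue_append,
    wordValue_append, wordValue_wordConj, wordValue_singleton, wordValue_singleton]
  rfl

theorem wordValue_identificationWord_eq_one_iff (x : Fin 4 → K) (i : ℤ) :
    wordValue x (identificationWord i) = 1 ↔
      x 0 ^ i * x 1 * x 0 ^ (-i) = x 2 ^ i * x 3 * x 2 ^ (-i) := by
  rw [identificationWord, wordValue_append, wordValue_invRev, mul_inv_eq_one,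
    wordValue_wordConj, wordValue_wordConj, wordValue_singleton, wordValue_singleton,
    wordValue_singleton, wordValue_singleton]

theorem map_u (φ : Lamplighter →* K) (i : ℤ) : φ (u i) = φ a ^ i * φ ε * φ a ^ (-i) := by
  simp [u]

theorem wordValue_pairGen_identificationWord_eq_one_iff (φ₁ φ₂ : Lamplighter →* K) (i : ℤ) :
    wordValue (pairGen φ₁ φ₂) (identificationWord i) = 1 ↔ φ₁ (u i) = φ₂ (u i) := by
  rw [wordValue_identificationWord_eq_one_iff, map_u, map_u]
  rfl

theorem commute_ε_u (φ : Lamplighter →* K) (i : ℤ) :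
    Commute (φ ε) (φ a ^ i * φ ε * φ a ^ (-i)) := by
  rw [← map_u, ← u_zero]
  refine Commute.map ?_ φ
  rw [u_eq, u_eq]
  exact (Commute.all _ _).map _

theorem ε_mul_ε : (ε * ε : Lamplighter) = 1 := by
  rw [← inv_eq_iff_mul_eq_one, ε_inv]

theorem wordValue_pairGen_squareWord (φ₁ φ₂ : Lamplighter →* K) {e : Fin 4} (he : e = 1 ∨ e = 3) :
    wordValue (pairGen φ₁ φ₂) (squareWord e) = 1 := by
  rw [wordValue_squareWord]
  rcases he with rfl | rfl
  · change φ₁ ε * φ₁ ε = 1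
    rw [← map_mul, ε_mul_ε, map_one]
  · change φ₂ ε * φ₂ ε = 1
    rw [← map_mul, ε_mul_ε, map_one]

theorem exists_pairGen_eq {x : Fin 4 → K} (h₁ : wordValue x (squareWord 1) = 1)
    (h₃ : wordValue x (squareWord 3) = 1) (h₀₁ : ∀ i, wordValue x (commutatorWord 0 1 i) = 1)
    (h₂₃ : ∀ i, wordValue x (commutatorWord 2 3 i) = 1) :
    ∃ φ₁ φ₂ : Lamplighter →* K, pairGen φ₁ φ₂ = x := by
  rw [wordValue_squareWord] at h₁ h₃
  simp only [wordValue_commutatorWord_eq_one_iff] at h₀₁ h₂₃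
  obtain ⟨φ₁, h1, h2⟩ := exists_lamplighter_hom _ _ h₁ h₀₁
  obtain ⟨φ₂, h3, h4⟩ := exists_lamplighter_hom _ _ h₃ h₂₃
  refine ⟨φ₁, φ₂, ?_⟩
  funext k
  fin_cases k
  exacts [h1, h2, h3, h4]

/-- The relators of the standard presentation of `L(A)`. -/
def relators (A : Set ℤ) : Set (GroupWord 4) :=
  {w | (w = squareWord 1 ∨ w = squareWord 3) ∨ ∃ i : ℤ, (w = commutatorWord 0 1 i ∨
    w = commutatorWord 2 3 i) ∨ (w = identificationWord i ∧ i ∈ A)}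

/-- For the harder inclusion, the quotient by the relators receives two morphisms from L that agree
on u_i for i ∈ A, hence a morphism from L(A). The quotient map thus factors through L(A), which
bounds the kernel. -/
theorem normalClosure_relators (A : Set ℤ) :
    Subgroup.normalClosure (FreeGroup.mk '' relators A) = (FreeGroup.lift (stdGen A)).ker := by
  refine le_antisymm (Subgroup.normalClosure_le_normal ?_) fun y hy => ?_
  · rintro _ ⟨w, hw, rfl⟩
    change wordValue (stdGen A) w = 1
    rcases hw with (rfl | rfl) | ⟨i, (rfl | rfl) | ⟨rfl, hi⟩⟩
    · exact wordValue_pairGen_squareWord _ _ (Or.inl rfl)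
    · exact wordValue_pairGen_squareWord _ _ (Or.inr rfl)
    · exact (wordValue_commutatorWord_eq_one_iff ..).2 (commute_ε_u (inl A) i)
    · exact (wordValue_commutatorWord_eq_one_iff ..).2 (commute_ε_u (inr A) i)
    · exact (wordValue_pairGen_identificationWord_eq_one_iff ..).2 (inl_u_eq_inr_u hi)
  · set N := Subgroup.normalClosure (FreeGroup.mk '' relators A)
    let x : Fin 4 → FreeGroup (Fin 4) ⧸ N := fun k => QuotientGroup.mk' N (FreeGroup.of k)
    have hx : FreeGroup.lift x = QuotientGroup.mk' N := FreeGroup.ext_hom _ _ (by simp [x])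
    have hrel : ∀ w ∈ relators A, wordValue x w = 1 := by
      intro w hw
      rw [wordValue, hx]
      exact (QuotientGroup.eq_one_iff _).2 (Subgroup.subset_normalClosure ⟨w, hw, rfl⟩)
    obtain ⟨φ₁, φ₂, hφ⟩ := exists_pairGen_eq (hrel _ (Or.inl (Or.inl rfl)))
      (hrel _ (Or.inl (Or.inr rfl))) (fun i => hrel _ (Or.inr ⟨i, Or.inl (Or.inl rfl)⟩))
      (fun i => hrel _ (Or.inr ⟨i, Or.inl (Or.inr rfl)⟩))
    obtain ⟨φ, h1, h2⟩ := exists_dysonGroup_hom (A := A) (φ₁ := φ₁) (φ₂ := φ₂) fun i hi => by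
      rw [← wordValue_pairGen_identificationWord_eq_one_iff, hφ]
      exact hrel _ (Or.inr ⟨i, Or.inr ⟨rfl, hi⟩⟩)
    have h3 : φ.comp (FreeGroup.lift (stdGen A)) = QuotientGroup.mk' N := by
      rw [← hx, ← hφ, ← h1, ← h2, ← map_pairGen]
      exact FreeGroup.ext_hom _ _ (by simp [stdGen])
    rw [← QuotientGroup.ker_mk' N, ← h3, MonoidHom.mem_ker, MonoidHom.comp_apply, hy, map_one]

theorem Primrec.commutatorWord (a e : Fin 4) : Primrec (commutatorWord a e) :=
  Primrec.list_append.comp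
    (Primrec.list_append.comp (Primrec.const _) (Primrec.wordConj _ _))
    (Primrec.invRev.comp (Primrec.list_append.comp (Primrec.wordConj _ _) (Primrec.const _)))

theorem Primrec.identificationWord : Primrec identificationWord :=
  Primrec.list_append.comp (Primrec.wordConj _ _) (Primrec.invRev.comp (Primrec.wordConj _ _))

theorem re_relators {A : Set ℤ} (hA : REPred fun n : ℤ => n ∈ A) :
    REPred fun w => w ∈ relators A := by
  have h1 : ∀ v : GroupWord 4, REPred fun w : GroupWord 4 => w = v := fun v =>
    (Primrec.eq.comp Primrec.id (Primrec.const v)).re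
  have h2 : ∀ f : ℤ → GroupWord 4, Primrec f → REPred fun p : GroupWord 4 × ℤ => p.1 = f p.2 :=
    fun f hf => (Primrec.eq.comp Primrec.fst (hf.comp Primrec.snd)).re
  exact ((h1 _).or (h1 _)).or (REPred.exists (((h2 _ (Primrec.commutatorWord 0 1)).or
    (h2 _ (Primrec.commutatorWord 2 3))).or
      ((h2 _ Primrec.identificationWord).and (hA.comp Computable.snd))))

theorem isREGroup {A : Set ℤ} (hA : REPred fun n : ℤ => n ∈ A) : IsREGroup (DysonGroup A) :=
  ⟨4, stdGen A, generates_stdGen A, relators A, re_relators hA, normalClosure_relators A⟩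

/-- The indices are recursively translated into words. -/
theorem exists_primrec_word {A : Set ℤ} {n : ℕ} {g : Fin n → DysonGroup A} (hg : Generates g) :
    ∃ W : ℤ → GroupWord n, Primrec W ∧
      ∀ i, wordValue g (W i) = inl A (u i) * (inr A (u i))⁻¹ := by
  obtain ⟨w₀, h₀⟩ := hg.exists_wordValue (inl A a)
  obtain ⟨w₁, h₁⟩ := hg.exists_wordValue (inl A ε)
  obtain ⟨w₂, h₂⟩ := hg.exists_wordValue (inr A a)
  obtain ⟨w₃, h₃⟩ := hg.exists_wordValue (inr A ε)
  refine ⟨fun i => wordConj w₀ w₁ i ++ FreeGroup.invRev (wordConj w₂ w₃ i),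
    Primrec.list_append.comp (Primrec.wordConj _ _) (Primrec.invRev.comp (Primrec.wordConj _ _)),
    fun i => ?_⟩
  rw [wordValue_append, wordValue_invRev, wordValue_wordConj, wordValue_wordConj, h₀, h₁, h₂, h₃,
    map_u, map_u]

theorem exists_primrec_word_eq_one_iff {A : Set ℤ} {n : ℕ} {g : Fin n → DysonGroup A}
    (hg : Generates g) :
    ∃ W : ℤ → GroupWord n, Primrec W ∧ ∀ i, wordValue g (W i) = 1 ↔ i ∈ A := by
  obtain ⟨W, hW, h⟩ := exists_primrec_word hg
  refine ⟨W, hW, fun i => ?_⟩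
  rw [h, mul_inv_eq_one, inl_u_eq_inr_u_iff]

theorem re_of_isREGroup {A : Set ℤ} (h : IsREGroup (DysonGroup A)) :
    REPred fun n : ℤ => n ∈ A := by
  obtain ⟨n, g, hg, h⟩ := h.exists_generates
  obtain ⟨W, hW, hWA⟩ := exists_primrec_word_eq_one_iff hg
  exact (h.comp hW.to_comp).of_eq hWA

theorem co_re_of_isCoREGroup {A : Set ℤ} (h : IsCoREGroup (DysonGroup A)) :
    REPred fun n : ℤ => n ∉ A := by
  obtain ⟨n, g, hg, h⟩ := h
  obtain ⟨W, hW, hWA⟩ := exists_primrec_word_eq_one_iff hg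
  exact (h.comp hW.to_comp).of_eq fun i => not_congr (hWA i)

end Presentation

/-! ### Residual finiteness -/

section ResiduallyFinite

theorem zpow_eq_zpow_of_card_dvd_sub {F : Type*} [Group F] {i j : ℤ}
    (h : (Nat.card F : ℤ) ∣ i - j) (x : F) : x ^ i = x ^ j := by
  rw [← sub_add_cancel i j, zpow_add, mul_eq_right]
  obtain ⟨k, hk⟩ := h
  rw [hk, zpow_mul, zpow_natCast, pow_card_eq_one', one_zpow]

theorem map_u_eq_of_card_dvd_sub {F : Type*} [Group F] (φ : Lamplighter →* F) {i j : ℤ}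
    (h : (Nat.card F : ℤ) ∣ i - j) : φ (u i) = φ (u j) := by
  rw [map_u, map_u, zpow_neg, zpow_neg, zpow_eq_zpow_of_card_dvd_sub h]

/-- Both images of u_i depend only on i modulo the order of F, so an element of A in the class of n
would identify the two images of u_n. For infinite F, `Nat.card F` is 0 and the class is reduced to
n. -/
theorem notMem_of_map_ne {A : Set ℤ} {F : Type*} [Group F] (φ : DysonGroup A →* F) {n : ℤ}
    (h : φ (inl A (u n) * (inr A (u n))⁻¹) ≠ 1) (k : ℤ) : n + Nat.card F * k ∉ A := by
  intro hA
  refine h ?_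
  have h1 := map_u_eq_of_card_dvd_sub (φ.comp (inl A)) (i := n + Nat.card F * k) (j := n)
    (by simp)
  have h2 := map_u_eq_of_card_dvd_sub (φ.comp (inr A)) (i := n + Nat.card F * k) (j := n)
    (by simp)
  rw [MonoidHom.comp_apply, MonoidHom.comp_apply] at h1 h2
  rw [map_mul, map_inv, ← h1, ← h2, inl_u_eq_inr_u hA, mul_inv_cancel]

theorem isOpen_profiniteTopology_int_iff {O : Set ℤ} :
    @IsOpen ℤ (profiniteTopology ℤ) O ↔ ∀ n ∈ O, ∃ p : ℤ, p ≠ 0 ∧ ∀ k, n + p * k ∈ O := by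
  constructor
  · intro h
    induction h with
    | basic S hS =>
      obtain ⟨N, x, -, hN, rfl⟩ := hS
      rintro _ ⟨l, hl, rfl⟩
      refine ⟨N.index, by exact_mod_cast hN.index_ne_zero, fun k => ⟨l + N.index * k, ?_, by ring⟩⟩
      refine N.add_mem hl ?_
      have : (N.index * k : ℤ) = N.index • k := by simp
      rw [this]
      exact N.nsmul_index_mem k
    | univ => exact fun n _ => ⟨1, one_ne_zero, fun _ => trivial⟩
    | inter S T _ _ hS hT =>
      rintro n ⟨hnS, hnT⟩
      obtain ⟨p, hp, hp'⟩ := hS n hnS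
      obtain ⟨q, hq, hq'⟩ := hT n hnT
      refine ⟨p * q, mul_ne_zero hp hq, fun k => ⟨?_, ?_⟩⟩
      · rw [mul_assoc]
        exact hp' _
      · rw [mul_comm p, mul_assoc]
        exact hq' _
    | sUnion C _ hC =>
      rintro n ⟨S, hS, hn⟩
      obtain ⟨p, hp, hp'⟩ := hC S hS n hn
      exact ⟨p, hp, fun k => ⟨S, hS, hp' k⟩⟩
  · intro h
    let _ := profiniteTopology ℤ
    refine isOpen_iff_forall_mem_open.2 fun n hn => ?_
    obtain ⟨p, hp, hp'⟩ := h n hn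
    refine ⟨{y | ∃ k ∈ AddSubgroup.zmultiples p, y = n + k}, ?_, ?_, ?_⟩
    · rintro _ ⟨_, ⟨k, rfl⟩, rfl⟩
      have := hp' k
      rwa [mul_comm] at this
    · refine TopologicalSpace.isOpen_generateFrom_of_mem ⟨_, n, inferInstance, ?_, rfl⟩
      exact ⟨by simpa [Int.index_zmultiples] using hp⟩
    · exact ⟨0, AddSubgroup.zero_mem _, by simp⟩

theorem isClosed_profiniteTopology_int_iff {A : Set ℤ} :
    @IsClosed ℤ (profiniteTopology ℤ) A ↔ ∀ n ∉ A, ∃ p : ℤ, p ≠ 0 ∧ ∀ k, n + p * k ∉ A := by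
  rw [← @isOpen_compl_iff ℤ A (profiniteTopology ℤ), isOpen_profiniteTopology_int_iff]
  rfl

theorem exists_finite_quotient_of_isClosed {A : Set ℤ} {q : ℤ → ℤ} (hq : ∀ n, q n ≠ 0)
    (hqA : ∀ n ∉ A, ∀ k, n + q n * k ∉ A) {w : GroupWord 4} (hw : wordValue (stdGen A) w ≠ 1) :
    ∃ (F : Type) (_ : Group F) (_ : Finite F) (φ : DysonGroup A →* F),
      φ (wordValue (stdGen A) w) ≠ 1 := by
  obtain ⟨F, _, _, φ₁, φ₂, h1, h2⟩ := exists_finite_separating_word hw hq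
  obtain ⟨φ, h3, h4⟩ := exists_dysonGroup_hom (A := A) (φ₁ := φ₁) (φ₂ := φ₂) (by
    intro i hi
    rcases h2 i with h | ⟨n, hn, -, k, hk⟩
    · exact h
    · refine (hqA n hn k ?_).elim
      rwa [← hk, add_sub_cancel])
  refine ⟨F, _, inferInstance, φ, ?_⟩
  rwa [map_wordValue, stdGen, map_pairGen, h3, h4]

theorem residuallyFinite_iff (A : Set ℤ) :
    Group.ResiduallyFinite (DysonGroup A) ↔ @IsClosed ℤ (profiniteTopology ℤ) A := by
  rw [isClosed_profiniteTopology_int_iff]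
  constructor
  · intro h n hn
    obtain ⟨H, hH⟩ := Group.exists_finiteIndexNormalSubgroup_notMem
      (inl A (u n) * (inr A (u n))⁻¹)
      (by rwa [Ne, mul_inv_eq_one, inl_u_eq_inr_u_iff])
    refine ⟨Nat.card (DysonGroup A ⧸ H.toSubgroup), ?_,
      notMem_of_map_ne (QuotientGroup.mk' H.toSubgroup) ?_⟩
    · exact_mod_cast Nat.card_pos.ne'
    · exact fun h => hH ((QuotientGroup.eq_one_iff _).1 h)
  · intro h
    choose! q hq hqA using h
    refine Group.residuallyFinite_of_forall_exists_finite_monoidHom fun x hx => ?_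
    obtain ⟨w, rfl⟩ := (generates_stdGen A).exists_wordValue x
    classical
    -- The moduli must be non-zero everywhere; their values on A are irrelevant.
    refine exists_finite_quotient_of_isClosed (q := fun n => if n ∈ A then 1 else q n)
      (fun n => ?_) (fun n hn => ?_) hx
    · split_ifs with hn
      exacts [one_ne_zero, hq n hn]
    · simpa [hn] using hqA n hn

end ResiduallyFinite

end Dyson

/-! ### Multiplication tables -/

/-- A description of a morphism, completed with the number of the identity and the numbers of the
inverses of the images of the generators. -/
abbrev GroupCode : Type := MorphismCode × (ℕ × List ℕ)

namespace GroupCode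

/-- The number of elements. -/
def size (d : GroupCode) : ℕ := d.1.1.length

/-- The product read off the multiplication table. -/
def mul (d : GroupCode) (x y : ℕ) : ℕ := (d.1.1.getD x []).getD y 0

/-- The number of the identity. -/
def one (d : GroupCode) : ℕ := d.2.1

/-- The image of a generator. -/
def gen (d : GroupCode) (k : ℕ) : ℕ := d.1.2.getD k 0

/-- The inverse of the image of a generator. -/
def genInv (d : GroupCode) (k : ℕ) : ℕ := d.2.2.getD k 0

/-- The value of a word. -/
def eval {n : ℕ} (d : GroupCode) (w : GroupWord n) : ℕ :=
  w.foldr (fun x r => d.mul (cond x.2 (d.gen x.1) (d.genInv x.1)) r) d.one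

/-- The first component of `d` describes the tuple `x` of elements of a finite group, and the
second one its identity and the inverses of the components of `x`. -/
def Represents {F : Type} [Group F] {n : ℕ} (x : Fin n → F) (d : GroupCode) : Prop :=
  ∃ (m : ℕ) (e : F ≃ Fin m),
    d.1.1 = List.ofFn (fun i : Fin m => List.ofFn (fun j : Fin m =>
      (e (e.symm i * e.symm j) : ℕ))) ∧
    d.1.2 = List.ofFn (fun k : Fin n => (e (x k) : ℕ)) ∧
    d.one = e 1 ∧ ∀ k : Fin n, d.genInv k = e (x k)⁻¹

/-- The table of `d` is the multiplication table of a group, in which `n` elements are given. -/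
def IsGroupTable (n : ℕ) (d : GroupCode) : Prop :=
  (∀ r ∈ d.1.1, r.length = d.size) ∧
    (∀ x < d.size, ∀ y < d.size, d.mul x y < d.size) ∧
    (∀ x < d.size, ∀ y < d.size, ∀ z < d.size, d.mul (d.mul x y) z = d.mul x (d.mul y z)) ∧
    (∀ x < d.size, d.mul d.one x = x) ∧
    (∀ x < d.size, ∃ y < d.size, d.mul y x = d.one) ∧
    d.1.2.length = n ∧ ∀ x ∈ d.1.2, x < d.size

/-- The identity and the inverses are correctly given. -/
def IsCompleted (n : ℕ) (d : GroupCode) : Prop :=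
  d.one < d.size ∧ d.mul d.one d.one = d.one ∧
    ∀ k < n, d.genInv k < d.size ∧ d.mul (d.gen k) (d.genInv k) = d.one

theorem gen_eq {F : Type} {n : ℕ} {x : Fin n → F} {d : GroupCode} {m : ℕ} {e : F ≃ Fin m}
    (h : d.1.2 = List.ofFn (fun k : Fin n => (e (x k) : ℕ))) (k : Fin n) : d.gen k = e (x k) := by
  rw [gen, h, List.getD_eq_getElem _ _ (by simp), List.getElem_ofFn]

section Correctness

variable {F : Type} [Group F] {n : ℕ} {x : Fin n → F} {d : GroupCode}

theorem mul_eq {m : ℕ} {e : F ≃ Fin m} (h : d.1.1 = List.ofFn (fun i : Fin m =>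
    List.ofFn (fun j : Fin m => (e (e.symm i * e.symm j) : ℕ)))) (y z : F) :
    d.mul (e y) (e z) = e (y * z) := by
  have h1 : d.1.1.getD (e y) [] = List.ofFn fun j : Fin m => (e (y * e.symm j) : ℕ) := by
    rw [h, List.getD_eq_getElem _ _ (by simp), List.getElem_ofFn]
    simp
  rw [mul, h1, List.getD_eq_getElem _ _ (by simp), List.getElem_ofFn]
  simp

theorem Represents.eval_eq_one_iff (h : Represents x d) (w : GroupWord n) :
    d.eval w = d.one ↔ wordValue x w = 1 := by
  obtain ⟨m, e, h1, h2, h3, h4⟩ := h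
  have key : d.eval w = e (wordValue x w) := by
    induction w with
    | nil => simpa [eval] using h3
    | cons y w ih =>
      rw [wordValue_cons, ← mul_eq h1, ← ih]
      obtain ⟨k, b⟩ := y
      cases b
      · rw [cond_false, ← h4]
        rfl
      · rw [cond_true, ← gen_eq h2]
        rfl
  rw [key, h3]
  simp [Fin.val_inj]

theorem Represents.card_eq (h : Represents x d) : Nat.card F = d.size := by
  obtain ⟨m, e, h1, -⟩ := h
  rw [Nat.card_congr e, Nat.card_fin, size, h1, List.length_ofFn]

theorem Represents.describes {G : Type*} [Group G] {g : Fin n → G} {φ : G →* F}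
    (h : Represents (fun k => φ (g k)) d) : Describes g φ d.1 := by
  obtain ⟨m, e, h1, h2, -⟩ := h
  exact ⟨m, e, h1, h2⟩

/-- In a group an idempotent is the identity and a right inverse is the inverse, so the decidable
checks of `IsCompleted` pin down the added data. That data is needed to evaluate words containing
inverse letters. -/
theorem represents_of_describes {G : Type*} [Group G] {g : Fin n → G} {φ : G →* F}
    (h : Describes g φ d.1) (hd : d.IsCompleted n) : Represents (fun k => φ (g k)) d := by
  obtain ⟨m, e, h1, h2⟩ := h
  obtain ⟨h3, h4, h5⟩ := hd
  have hsize : d.size = m := by rw [size, h1, List.length_ofFn]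
  rw [hsize] at h3 h5
  have hone : d.one = e 1 := by
    obtain ⟨y, hy⟩ := e.surjective ⟨d.one, h3⟩
    have hy' : d.one = e y := by rw [hy]
    rw [hy', mul_eq h1, Fin.val_inj, e.apply_eq_iff_eq, mul_eq_left] at h4
    rw [hy', h4]
  refine ⟨m, e, h1, h2, hone, fun k => ?_⟩
  obtain ⟨h6, h7⟩ := h5 k k.2
  obtain ⟨y, hy⟩ := e.surjective ⟨d.genInv k, h6⟩
  have hy' : d.genInv k = e y := by rw [hy]
  rw [hy', hone, gen_eq (x := fun k => φ (g k)) h2, mul_eq h1, Fin.val_inj,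
    e.apply_eq_iff_eq] at h7
  rw [hy', eq_inv_of_mul_eq_one_right h7]

theorem exists_isCompleted_of_describes {G : Type*} [Group G] {g : Fin n → G} {φ : G →* F}
    {c : MorphismCode} (h : Describes g φ c) : ∃ s, IsCompleted n (c, s) := by
  obtain ⟨m, e, h1, h2⟩ := h
  let s : ℕ × List ℕ := (e 1, List.ofFn fun k : Fin n => (e (φ (g k))⁻¹ : ℕ))
  have h1' : ((c, s) : GroupCode).1.1 = _ := h1
  have hsize : size (c, s) = m := by simp [size, h1]
  have hinv : ∀ k : Fin n, genInv (c, s) k = e (φ (g k))⁻¹ := fun k => by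
    rw [genInv, List.getD_eq_getElem _ _ (by simp [s]), List.getElem_ofFn]
  refine ⟨s, ?_, ?_, fun k hk => ?_⟩
  · rw [hsize]
    exact (e 1).2
  · change mul _ (e 1 : ℕ) (e 1 : ℕ) = _
    rw [mul_eq h1', mul_one]
    rfl
  · have hk' := hinv ⟨k, hk⟩
    have hgen := gen_eq (d := (c, s)) (x := fun k => φ (g k)) h2 ⟨k, hk⟩
    dsimp only at hk' hgen
    rw [hsize, hk', hgen, mul_eq h1', mul_inv_cancel]
    exact ⟨Fin.isLt _, rfl⟩

theorem exists_represents [Finite F] (x : Fin n → F) :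
    ∃ d, IsGroupTable n d ∧ IsCompleted n d ∧ Represents x d := by
  obtain ⟨m, ⟨e⟩⟩ := Finite.exists_equiv_fin F
  let c : MorphismCode := (List.ofFn (fun i : Fin m => List.ofFn (fun j : Fin m =>
      (e (e.symm i * e.symm j) : ℕ))), List.ofFn (fun k : Fin n => (e (x k) : ℕ)))
  have hc : Describes x (MonoidHom.id F) c := ⟨m, e, rfl, rfl⟩
  obtain ⟨s, hs⟩ := exists_isCompleted_of_describes hc
  have hr : Represents x (c, s) := represents_of_describes (d := (c, s)) hc hs
  refine ⟨(c, s), ?_, hs, hr⟩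
  have h1 : ((c, s) : GroupCode).1.1 = List.ofFn (fun i : Fin m => List.ofFn (fun j : Fin m =>
      (e (e.symm i * e.symm j) : ℕ))) := rfl
  have hsize : size (c, s) = m := by simp [size, c]
  have hsurj : ∀ y < m, ∃ z, y = e z := fun y hy => ⟨e.symm ⟨y, hy⟩, by simp⟩
  have hone : one (c, s) = e 1 := by
    obtain ⟨y, hy⟩ := hsurj _ (hsize ▸ hs.1)
    have h4 := hs.2.1
    rw [hy, mul_eq h1, Fin.val_inj, e.apply_eq_iff_eq, mul_eq_left] at h4
    rw [hy, h4]
  rw [IsGroupTable, hsize, hone]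
  refine ⟨?_, ?_, ?_, ?_, ?_, by simp [c], ?_⟩
  · simp [c, List.mem_ofFn']
  · intro y hy z hz
    obtain ⟨y, rfl⟩ := hsurj y hy
    obtain ⟨z, rfl⟩ := hsurj z hz
    rw [mul_eq h1]
    exact Fin.isLt _
  · intro y hy z hz t ht
    obtain ⟨y, rfl⟩ := hsurj y hy
    obtain ⟨z, rfl⟩ := hsurj z hz
    obtain ⟨t, rfl⟩ := hsurj t ht
    rw [mul_eq h1, mul_eq h1, mul_eq h1, mul_eq h1, mul_assoc]
  · intro y hy
    obtain ⟨y, rfl⟩ := hsurj y hy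
    rw [mul_eq h1, one_mul]
  · intro y hy
    obtain ⟨y, rfl⟩ := hsurj y hy
    exact ⟨e y⁻¹, Fin.isLt _, by rw [mul_eq h1, inv_mul_cancel]⟩
  · intro y hy
    obtain ⟨k, rfl⟩ := List.mem_ofFn.1 hy
    exact Fin.isLt _

end Correctness

theorem IsGroupTable.exists_represents {n : ℕ} {d : GroupCode} (h : IsGroupTable n d)
    (hd : IsCompleted n d) : ∃ (F : Type) (_ : Group F) (_ : Finite F) (x : Fin n → F),
      Represents x d := by
  obtain ⟨h1, h2, h3, h4, h5, h6, h7⟩ := h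
  choose! i hi hi' using h5
  let F : Type := {y : ℕ // y < d.size}
  let _ : Mul F := ⟨fun y z => ⟨d.mul y z, h2 y y.2 z z.2⟩⟩
  let _ : One F := ⟨⟨d.one, hd.1⟩⟩
  let _ : Inv F := ⟨fun y => ⟨i y, hi y y.2⟩⟩
  let _ : Group F := Group.ofLeftAxioms (fun y z t => Subtype.ext (h3 y y.2 z z.2 t t.2))
    (fun y => Subtype.ext (h4 y y.2)) (fun y => Subtype.ext (hi' y y.2))
  let e : F ≃ Fin d.size := Fin.equivSubtype.symm
  have hgen : ∀ k : Fin n, d.gen k < d.size := by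
    intro k
    have hk : (k : ℕ) < d.1.2.length := h6 ▸ k.2
    rw [gen, List.getD_eq_getElem _ _ hk]
    exact h7 _ (List.getElem_mem hk)
  let x : Fin n → F := fun k => ⟨d.gen k, hgen k⟩
  have hdesc : Describes x (MonoidHom.id F) d.1 := by
    refine ⟨d.size, e, ?_, ?_⟩
    · refine List.ext_getElem (by simp [size]) fun j hj hj' => ?_
      rw [List.getElem_ofFn]
      have hl := h1 _ (List.getElem_mem hj)
      refine List.ext_getElem (by simp [hl]) fun l hl1 hl2 => ?_
      rw [List.getElem_ofFn]
      change _ = d.mul j l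
      rw [mul, List.getD_eq_getElem _ _ hj, List.getD_eq_getElem _ _ hl1]
    · refine List.ext_getElem (by simp [h6]) fun j hj hj' => ?_
      rw [List.getElem_ofFn]
      change _ = d.gen j
      rw [gen, List.getD_eq_getElem _ _ hj]
  exact ⟨F, _, inferInstanceAs (Finite {y : ℕ // y < d.size}), x, represents_of_describes hdesc hd⟩

/-! ### Primitive recursiveness of the checks on tables -/

section Primrec

open _root_.Primrec

theorem primrec_size : Primrec size := list_length.comp (fst.comp fst)

theorem primrec_one : Primrec one := fst.comp snd

theorem primrec_mul {α : Type*} [Primcodable α] {d : α → GroupCode} {x y : α → ℕ}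
    (hd : Primrec d) (hx : Primrec x) (hy : Primrec y) : Primrec fun t => (d t).mul (x t) (y t) :=
  (list_getD 0).comp ((list_getD []).comp (fst.comp (fst.comp hd)) hx) hy

theorem primrec_gen : Primrec₂ gen := (list_getD 0).comp (snd.comp (fst.comp fst)) snd

theorem primrec_genInv : Primrec₂ genInv := (list_getD 0).comp (snd.comp (snd.comp fst)) snd

theorem primrec_eval {n : ℕ} : Primrec₂ (eval : GroupCode → GroupWord n → ℕ) := by
  have hk : Primrec fun t : (GroupCode × GroupWord n) × ((Fin n × Bool) × ℕ) => (t.2.1.1 : ℕ) :=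
    fin_val.comp (fst.comp (fst.comp snd))
  have h : Primrec fun t : (GroupCode × GroupWord n) × ((Fin n × Bool) × ℕ) =>
      t.1.1.mul (cond t.2.1.2 (t.1.1.gen t.2.1.1) (t.1.1.genInv t.2.1.1)) t.2.2 :=
    primrec_mul (fst.comp fst)
      (cond (snd.comp (fst.comp snd)) (primrec_gen.comp (fst.comp fst) hk)
        (primrec_genInv.comp (fst.comp fst) hk)) (snd.comp snd)
  exact list_foldr (α := GroupCode × GroupWord n) (β := Fin n × Bool) (σ := ℕ) snd
    (primrec_one.comp fst) h.to₂

/-- Bounded universal quantification with a parameter. -/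
theorem _root_.PrimrecPred.forall_lt_param {α : Type*} [Primcodable α] {p : α × ℕ → Prop}
    {b : α → ℕ} (hp : PrimrecPred p) (hb : Primrec b) :
    PrimrecPred fun a => ∀ x < b a, p (a, x) := by
  have h : PrimrecRel fun (x : ℕ) (a : α) => p (a, x) := hp.comp (snd.pair fst)
  exact (h.forall_mem_list.comp (list_range.comp hb) Primrec.id).of_eq fun a => by simp

/-- Bounded existential quantification with a parameter. -/
theorem _root_.PrimrecPred.exists_lt_param {α : Type*} [Primcodable α] {p : α × ℕ → Prop}
    {b : α → ℕ} (hp : PrimrecPred p) (hb : Primrec b) :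
    PrimrecPred fun a => ∃ x < b a, p (a, x) := by
  have h : PrimrecRel fun (x : ℕ) (a : α) => p (a, x) := hp.comp (snd.pair fst)
  exact (h.exists_mem_list.comp (list_range.comp hb) Primrec.id).of_eq fun a => by simp

theorem primrecPred_isCompleted (n : ℕ) : PrimrecPred (IsCompleted n) := by
  refine .and (nat_lt.comp primrec_one primrec_size) (.and (Primrec.eq.comp
    (primrec_mul Primrec.id primrec_one primrec_one) primrec_one) ?_)
  refine PrimrecPred.forall_lt_param (p := fun t : GroupCode × ℕ =>
    t.1.genInv t.2 < t.1.size ∧ t.1.mul (t.1.gen t.2) (t.1.genInv t.2) = t.1.one) ?_ (const n)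
  exact .and (nat_lt.comp primrec_genInv (primrec_size.comp fst))
    (Primrec.eq.comp (primrec_mul fst primrec_gen primrec_genInv) (primrec_one.comp fst))

theorem primrecPred_isGroupTable (n : ℕ) : PrimrecPred (IsGroupTable n) := by
  have hs1 : Primrec fun t : GroupCode × ℕ => t.1.size := primrec_size.comp fst
  have hs2 : Primrec fun t : (GroupCode × ℕ) × ℕ => t.1.1.size := hs1.comp fst
  refine .and ?_ (.and ?_ (.and ?_ (.and ?_ (.and ?_ (.and ?_ ?_)))))
  · have h : PrimrecRel fun (r : List ℕ) (d : GroupCode) => r.length = d.size :=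
      Primrec.eq.comp (list_length.comp fst) (primrec_size.comp snd)
    exact h.forall_mem_list.comp (fst.comp fst) Primrec.id
  · refine PrimrecPred.forall_lt_param (p := fun t : GroupCode × ℕ =>
      ∀ y < t.1.size, t.1.mul t.2 y < t.1.size) ?_ primrec_size
    refine PrimrecPred.forall_lt_param (p := fun t : (GroupCode × ℕ) × ℕ =>
      t.1.1.mul t.1.2 t.2 < t.1.1.size) ?_ hs1
    exact nat_lt.comp (primrec_mul (fst.comp fst) (snd.comp fst) snd) hs2
  · refine PrimrecPred.forall_lt_param (p := fun t : GroupCode × ℕ =>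
      ∀ y < t.1.size, ∀ z < t.1.size, t.1.mul (t.1.mul t.2 y) z = t.1.mul t.2 (t.1.mul y z)) ?_
      primrec_size
    refine PrimrecPred.forall_lt_param (p := fun t : (GroupCode × ℕ) × ℕ =>
      ∀ z < t.1.1.size, t.1.1.mul (t.1.1.mul t.1.2 t.2) z = t.1.1.mul t.1.2 (t.1.1.mul t.2 z)) ?_
      hs1
    refine PrimrecPred.forall_lt_param (p := fun t : ((GroupCode × ℕ) × ℕ) × ℕ =>
      t.1.1.1.mul (t.1.1.1.mul t.1.1.2 t.1.2) t.2 =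
        t.1.1.1.mul t.1.1.2 (t.1.1.1.mul t.1.2 t.2)) ?_ hs2
    have hd : Primrec fun t : ((GroupCode × ℕ) × ℕ) × ℕ => t.1.1.1 := fst.comp (fst.comp fst)
    have hx : Primrec fun t : ((GroupCode × ℕ) × ℕ) × ℕ => t.1.1.2 := snd.comp (fst.comp fst)
    have hy : Primrec fun t : ((GroupCode × ℕ) × ℕ) × ℕ => t.1.2 := snd.comp fst
    exact Primrec.eq.comp (primrec_mul hd (primrec_mul hd hx hy) snd)
      (primrec_mul hd hx (primrec_mul hd hy snd))
  · refine PrimrecPred.forall_lt_param (p := fun t : GroupCode × ℕ => t.1.mul t.1.one t.2 = t.2) ?_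
      primrec_size
    exact Primrec.eq.comp (primrec_mul fst (primrec_one.comp fst) snd) snd
  · refine PrimrecPred.forall_lt_param (p := fun t : GroupCode × ℕ =>
      ∃ y < t.1.size, t.1.mul y t.2 = t.1.one) ?_ primrec_size
    refine PrimrecPred.exists_lt_param (p := fun t : (GroupCode × ℕ) × ℕ =>
      t.1.1.mul t.2 t.1.2 = t.1.1.one) ?_ hs1
    exact Primrec.eq.comp (primrec_mul (fst.comp fst) snd (snd.comp fst))
      (primrec_one.comp (fst.comp fst))
  · exact Primrec.eq.comp (list_length.comp (snd.comp fst)) (const n)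
  · have h : PrimrecRel fun (x : ℕ) (d : GroupCode) => x < d.size :=
      nat_lt.comp fst (primrec_size.comp snd)
    exact h.forall_mem_list.comp (snd.comp fst) Primrec.id

end Primrec

end GroupCode

/-- An effectively residually finite group is co-r.e. -/
theorem IsEffectivelyResiduallyFinite.isCoREGroup {G : Type*} [Group G]
    (h : IsEffectivelyResiduallyFinite G) : IsCoREGroup G := by
  obtain ⟨n, g, hg, f, hf, h⟩ := h
  refine ⟨n, g, hg, ?_⟩
  -- A word is recognized by finding an output of f together with a completion under which the word
  -- does not evaluate to the identity.
  have hre : REPred fun p : GroupWord n × GroupCode => p.2.1 ∈ f p.1 ∧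
      (p.2.IsCompleted n ∧ p.2.eval p.1 ≠ p.2.one) := by
    refine REPred.and ((REPred.mem_graph hf).comp
      (Primrec.fst.pair (Primrec.fst.comp Primrec.snd)).to_comp) (PrimrecPred.re ?_)
    exact ((GroupCode.primrecPred_isCompleted n).comp Primrec.snd).and (PrimrecPred.not
      (Primrec.eq.comp (GroupCode.primrec_eval.comp Primrec.snd Primrec.fst)
        (GroupCode.primrec_one.comp Primrec.snd)))
  refine hre.exists.of_eq fun w => ⟨?_, fun hw => ?_⟩
  · rintro ⟨d, hd, hc, hne⟩ hw
    obtain ⟨F, _, φ, hφ⟩ := (h w).1 _ hd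
    refine hne (((GroupCode.represents_of_describes hφ hc).eval_eq_one_iff w).2 ?_)
    rw [← map_wordValue, hw, map_one]
  · obtain ⟨c, hc, F, _, φ, hφ, hne⟩ := (h w).2 hw
    obtain ⟨s, hs⟩ := GroupCode.exists_isCompleted_of_describes hφ
    refine ⟨(c, s), hc, hs, fun he => hne ?_⟩
    rw [map_wordValue]
    exact ((GroupCode.represents_of_describes (d := (c, s)) hφ hs).eval_eq_one_iff w).1 he

/-! ### Codes for pairs of morphisms from the lamplighter group -/

namespace GroupCode

open Dyson Lamplighter

/-- The code describes two morphisms from the lamplighter group to a finite group. -/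
def IsPairCode (d : GroupCode) : Prop :=
  (IsGroupTable 4 d ∧ IsCompleted 4 d) ∧
    (d.eval (squareWord 1) = d.one ∧ d.eval (squareWord 3) = d.one) ∧
      ∀ i < d.size, d.eval (commutatorWord 0 1 (i : ℕ)) = d.one ∧
        d.eval (commutatorWord 2 3 (i : ℕ)) = d.one

/-- Powers in F depend only on the exponent modulo the order, so finitely many of the infinitely
many commutator relators suffice; this makes `IsPairCode` decidable. -/
theorem wordValue_commutatorWord_eq_one_of_forall_lt {F : Type*} [Group F] [Finite F]
    {x : Fin 4 → F} {a e : Fin 4}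
    (h : ∀ i < Nat.card F, wordValue x (commutatorWord a e (i : ℕ)) = 1) (i : ℤ) :
    wordValue x (commutatorWord a e i) = 1 := by
  have hpos : (0 : ℤ) < Nat.card F := by exact_mod_cast Nat.card_pos
  have h1 := h (i % Nat.card F).toNat (by
    have := Int.emod_lt_of_pos i hpos
    have := Int.emod_nonneg i hpos.ne'
    omega)
  rw [Int.toNat_of_nonneg (Int.emod_nonneg i hpos.ne')] at h1
  rw [wordValue_commutatorWord_eq_one_iff] at h1 ⊢
  rwa [zpow_neg, zpow_eq_zpow_of_card_dvd_sub (j := i) (by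
    rw [dvd_sub_comm]
    exact Int.dvd_self_sub_emod), ← zpow_neg] at h1

theorem IsPairCode.exists_represents {d : GroupCode} (h : IsPairCode d) :
    ∃ (F : Type) (_ : Group F) (_ : Finite F) (φ₁ φ₂ : Lamplighter →* F),
      Represents (pairGen φ₁ φ₂) d := by
  obtain ⟨⟨h1, h2⟩, ⟨h3, h4⟩, h5⟩ := h
  obtain ⟨F, _, _, x, hx⟩ := h1.exists_represents h2
  simp only [hx.eval_eq_one_iff] at h3 h4 h5
  rw [← hx.card_eq] at h5
  obtain ⟨φ₁, φ₂, rfl⟩ := exists_pairGen_eq h3 h4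
    (wordValue_commutatorWord_eq_one_of_forall_lt fun i hi => (h5 i hi).1)
    (wordValue_commutatorWord_eq_one_of_forall_lt fun i hi => (h5 i hi).2)
  exact ⟨F, _, inferInstance, φ₁, φ₂, hx⟩

theorem exists_isPairCode {F : Type} [Group F] [Finite F] (φ₁ φ₂ : Lamplighter →* F) :
    ∃ d, IsPairCode d ∧ Represents (pairGen φ₁ φ₂) d := by
  obtain ⟨d, h1, h2, hd⟩ := GroupCode.exists_represents (pairGen φ₁ φ₂)
  refine ⟨d, ⟨⟨h1, h2⟩, ?_⟩, hd⟩
  simp only [hd.eval_eq_one_iff]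
  exact ⟨⟨wordValue_pairGen_squareWord _ _ (Or.inl rfl),
    wordValue_pairGen_squareWord _ _ (Or.inr rfl)⟩, fun i _ =>
    ⟨(wordValue_commutatorWord_eq_one_iff ..).2 (commute_ε_u φ₁ i),
      (wordValue_commutatorWord_eq_one_iff ..).2 (commute_ε_u φ₂ i)⟩⟩

theorem Represents.eval_identificationWord_iff {F : Type} [Group F] {φ₁ φ₂ : Lamplighter →* F}
    {d : GroupCode} (hd : Represents (pairGen φ₁ φ₂) d) (i : ℤ) :
    d.eval (identificationWord i) = d.one ↔ φ₁ (u i) = φ₂ (u i) := by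
  rw [hd.eval_eq_one_iff, wordValue_pairGen_identificationWord_eq_one_iff]

theorem primrecPred_eval_eq_one {α : Type*} [Primcodable α] {n : ℕ} {d : α → GroupCode}
    {w : α → GroupWord n} (hd : Primrec d) (hw : Primrec w) :
    PrimrecPred fun t => (d t).eval (w t) = (d t).one :=
  Primrec.eq.comp (primrec_eval.comp hd hw) (primrec_one.comp hd)

theorem primrecPred_isPairCode : PrimrecPred IsPairCode := by
  refine .and (.and (primrecPred_isGroupTable 4) (primrecPred_isCompleted 4)) (.and (.and
    (primrecPred_eval_eq_one Primrec.id (Primrec.const _))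
    (primrecPred_eval_eq_one Primrec.id (Primrec.const _))) ?_)
  refine PrimrecPred.forall_lt_param (p := fun t : GroupCode × ℕ =>
    t.1.eval (commutatorWord 0 1 t.2) = t.1.one ∧ t.1.eval (commutatorWord 2 3 t.2) = t.1.one) ?_
    primrec_size
  have hi := Primrec.int_natCast.comp (Primrec.snd (α := GroupCode) (β := ℕ))
  exact .and (primrecPred_eval_eq_one Primrec.fst ((Primrec.commutatorWord 0 1).comp hi))
    (primrecPred_eval_eq_one Primrec.fst ((Primrec.commutatorWord 2 3).comp hi))

end GroupCode

/-! ### The word problem of L(A) -/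

namespace Dyson

open Lamplighter GroupCode

/-- The right side is r.e. when the complement of A is. The integers t - 2ℓ run through the window
[-2ℓ, 2ℓ], ℓ the length of w, and the list holds indices outside A where the pair may disagree. The
pair need not factor through L(A): agreement on the part of A in the window is enough to conclude.
-/
theorem wordValue_stdGen_ne_one_iff {A : Set ℤ} (w : GroupWord 4) :
    wordValue (stdGen A) w ≠ 1 ↔ ∃ x : GroupCode × List ℤ,
      ((x.1.IsPairCode ∧ x.1.eval w ≠ x.1.one) ∧ ∀ t < 4 * w.length + 1,
        (t : ℤ) - (2 * w.length : ℕ) ∈ x.2 ∨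
          x.1.eval (identificationWord ((t : ℤ) - (2 * w.length : ℕ))) = x.1.one) ∧
      ∀ n ∈ x.2, n ∉ A := by
  classical
  constructor
  · intro hw
    obtain ⟨F, _, _, φ₁, φ₂, h1, h2⟩ := exists_finite_separating_word hw
      -- With this modulus, distinct indices of the window are never congruent, so disagreement in
      -- the window occurs only outside A.
      (q := fun _ => 4 * w.length + 1) (fun _ => by omega)
    obtain ⟨d, hd, hr⟩ := exists_isPairCode φ₁ φ₂
    refine ⟨(d, (Finset.Icc (-(2 * w.length : ℕ) : ℤ) (2 * w.length : ℕ)).toList.filter (· ∉ A)),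
      ⟨⟨hd, by rwa [Ne, hr.eval_eq_one_iff]⟩, fun t ht => ?_⟩, fun n hn => ?_⟩
    · rw [or_iff_not_imp_right, hr.eval_identificationWord_iff]
      intro hne
      obtain ⟨n, hn, hn1, hn2⟩ := (h2 _).resolve_left hne
      have hn3 := abs_le.1 hn1
      have h0 := Int.eq_zero_of_abs_lt_dvd hn2 (by rw [abs_lt]; constructor <;> omega)
      have h3 : (t : ℤ) - (2 * w.length : ℕ) = n := by omega
      rw [h3]
      simpa [hn] using hn3
    · simpa using (List.mem_filter.1 hn).2
  · rintro ⟨⟨d, T⟩, ⟨⟨hd, hw⟩, hT⟩, hA⟩ h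
    obtain ⟨F, _, _, φ₁, φ₂, hr⟩ := hd.exists_represents
    dsimp only at hw hT hA
    refine hw ((hr.eval_eq_one_iff w).2 (wordValue_pairGen_eq_one h fun i hi hi' => ?_))
    rw [← hr.eval_identificationWord_iff]
    have hi2 := abs_le.1 hi'
    have h1 := hT (i + (2 * w.length : ℕ)).toNat (by omega)
    rw [Int.toNat_of_nonneg (by omega), add_sub_cancel_right] at h1
    exact h1.resolve_left fun h2 => hA i h2 hi

theorem PrimrecRel.list_mem {α : Type*} [Primcodable α] :
    PrimrecRel fun (x : α) (l : List α) => x ∈ l :=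
  ((Primrec.eq (α := α)).exists_mem_list.comp Primrec.snd Primrec.fst).of_eq fun x => by simp

theorem re_wordValue_stdGen_ne_one {A : Set ℤ} (hA : REPred fun n : ℤ => n ∉ A) :
    REPred fun w : GroupWord 4 => wordValue (stdGen A) w ≠ 1 := by
  refine REPred.of_eq (REPred.exists (p := fun t : GroupWord 4 × (GroupCode × List ℤ) =>
    ((t.2.1.IsPairCode ∧ t.2.1.eval t.1 ≠ t.2.1.one) ∧ ∀ i < 4 * t.1.length + 1,
      (i : ℤ) - (2 * t.1.length : ℕ) ∈ t.2.2 ∨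
        t.2.1.eval (identificationWord ((i : ℤ) - (2 * t.1.length : ℕ))) = t.2.1.one) ∧
    ∀ n ∈ t.2.2, n ∉ A) ?_) fun w => (wordValue_stdGen_ne_one_iff w).symm
  refine REPred.and (PrimrecPred.re (.and (.and ?_ ?_) ?_)) ?_
  · exact primrecPred_isPairCode.comp (Primrec.fst.comp Primrec.snd)
  · exact (primrecPred_eval_eq_one (Primrec.fst.comp Primrec.snd) Primrec.fst).not
  · refine PrimrecPred.forall_lt_param
      (p := fun t : (GroupWord 4 × (GroupCode × List ℤ)) × ℕ =>
        (t.2 : ℤ) - (2 * t.1.1.length : ℕ) ∈ t.1.2.2 ∨ t.1.2.1.eval (identificationWord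
          ((t.2 : ℤ) - (2 * t.1.1.length : ℕ))) = t.1.2.1.one)
      (b := fun a : GroupWord 4 × (GroupCode × List ℤ) => 4 * a.1.length + 1) ?_ ?_
    · have hi : Primrec fun t : (GroupWord 4 × (GroupCode × List ℤ)) × ℕ =>
          (t.2 : ℤ) - (2 * t.1.1.length : ℕ) :=
        Primrec.int_subNat.comp Primrec.snd (Primrec.nat_mul.comp (Primrec.const 2)
          (Primrec.list_length.comp (Primrec.fst.comp Primrec.fst)))
      exact .or (PrimrecRel.list_mem.comp hi
          (Primrec.snd.comp (Primrec.snd.comp Primrec.fst)))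
        (primrecPred_eval_eq_one (Primrec.fst.comp (Primrec.snd.comp Primrec.fst))
          (Primrec.identificationWord.comp hi))
    · exact Primrec.succ.comp (Primrec.nat_mul.comp (Primrec.const 4)
        (Primrec.list_length.comp Primrec.fst))
  · exact REPred.forall_mem_list
      (p := fun t : (GroupWord 4 × (GroupCode × List ℤ)) × ℤ => t.2 ∉ A)
      (hA.comp Computable.snd) (Primrec.snd.comp Primrec.snd)

theorem isCoREGroup {A : Set ℤ} (hA : REPred fun n : ℤ => n ∉ A) : IsCoREGroup (DysonGroup A) :=
  ⟨4, stdGen A, generates_stdGen A, re_wordValue_stdGen_ne_one hA⟩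

theorem hasSolvableWordProblem_iff (A : Set ℤ) :
    HasSolvableWordProblem (DysonGroup A) ↔ ComputablePred fun n : ℤ => n ∈ A := by
  rw [ComputablePred.computable_iff_re_compl_re']
  constructor
  · rintro ⟨n, g, hg, h⟩
    obtain ⟨W, hW, hWA⟩ := exists_primrec_word_eq_one_iff hg
    exact ⟨(h.to_re.comp hW.to_comp).of_eq hWA,
      (h.not.to_re.comp hW.to_comp).of_eq fun i => not_congr (hWA i)⟩
  · rintro ⟨h1, h2⟩
    -- Both enumerations must concern the same generating tuple, so the explicit presentation is
    -- used.
    refine ⟨4, stdGen A, generates_stdGen A, ComputablePred.computable_iff_re_compl_re'.2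
      ⟨?_, re_wordValue_stdGen_ne_one h2⟩⟩
    obtain ⟨R, hR, h⟩ : ∃ R : Set (GroupWord 4), REPred (fun w => w ∈ R) ∧
        Subgroup.normalClosure (FreeGroup.mk '' R) = (FreeGroup.lift (stdGen A)).ker :=
      ⟨relators A, re_relators h1, normalClosure_relators A⟩
    exact hR.mem_normalClosure.of_eq fun w => by rw [h, MonoidHom.mem_ker]; rfl

/-! ### Effective residual finiteness -/

/-- The algorithm is run on the word for u_i û_i⁻¹; the number of rows of the table is the order of
the quotient, and this is the required period. -/
theorem isEffectivelyClosed_of_isEffectivelyResiduallyFinite {A : Set ℤ}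
    (h : IsEffectivelyResiduallyFinite (DysonGroup A)) : IsEffectivelyClosed A := by
  obtain ⟨n, g, hg, f, hf, h⟩ := h
  obtain ⟨W, hW, hWA⟩ := exists_primrec_word hg
  refine ⟨fun i => (f (W i)).map fun c => (c.1.length : ℤ), ?_, fun i hi => ?_⟩
  · refine (hf.comp hW.to_comp).map (Primrec.to_comp ?_)
    exact Primrec.int_natCast.comp (Primrec.list_length.comp (Primrec.fst.comp Primrec.snd))
  · have hne : wordValue g (W i) ≠ 1 := by
      rwa [hWA, Ne, mul_inv_eq_one, inl_u_eq_inr_u_iff]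
    obtain ⟨c, hc, F, _, φ, ⟨m, e, h1, -⟩, hφ⟩ := (h (W i)).2 hne
    have hcard : c.1.length = Nat.card F := by
      rw [h1, List.length_ofFn, Nat.card_congr e, Nat.card_fin]
    have hm : m ≠ 0 := by
      rintro rfl
      exact (e 1).elim0
    refine ⟨c.1.length, Part.mem_map _ hc, ?_, ?_⟩
    · rw [h1, List.length_ofFn]
      exact_mod_cast hm
    · rw [hWA] at hφ
      rw [hcard]
      exact notMem_of_map_ne φ hφ

/-- A certificate for a morphism from `L(A)` to a finite group that does not kill `w`: the data
completing the description, a common period, and witnesses for the indices not to be in `A`. -/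
abbrev Certificate : Type := ((ℕ × List ℕ) × ℕ) × List (ℤ × ℤ)

/-- The validity of a certificate, apart from its witnesses. -/
def IsCertificate (w : GroupWord 4) (c : MorphismCode) (x : Certificate) : Prop :=
  (IsPairCode (c, x.1.1) ∧ eval (c, x.1.1) w ≠ one (c, x.1.1)) ∧
    (x.1.2 ≠ 0 ∧ size (c, x.1.1) ∣ x.1.2) ∧
      ∀ i < x.1.2, eval (c, x.1.1) (identificationWord (i : ℕ)) = one (c, x.1.1) ∨
        ∃ y ∈ x.2, y.2 ∣ (x.1.2 : ℤ) ∧ y.2 ∣ (i : ℤ) - y.1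

/-- The order of the group divides the period N, so agreement at i ∈ A can be checked at i mod N. A
witness (n, r) there would have r dividing N, hence would put i itself in n + rℤ, which avoids A. -/
theorem IsCertificate.exists_describes {A : Set ℤ} {w : GroupWord 4} {c : MorphismCode}
    {x : Certificate} (h : IsCertificate w c x)
    (hx : ∀ y ∈ x.2, ∀ k : ℤ, y.1 + y.2 * k ∉ A) :
    ∃ (F : Type) (_ : Group F) (φ : DysonGroup A →* F), Describes (stdGen A) φ c ∧
      φ (wordValue (stdGen A) w) ≠ 1 := by
  obtain ⟨⟨s, N⟩, T⟩ := x
  obtain ⟨⟨hd, hw⟩, ⟨hN, hdvd⟩, hT⟩ := h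
  dsimp only at hd hw hN hdvd hT hx
  obtain ⟨F, _, _, φ₁, φ₂, hr⟩ := hd.exists_represents
  have hN' : (0 : ℤ) < N := by omega
  have hagree : ∀ i ∈ A, φ₁ (u i) = φ₂ (u i) := by
    intro i hi
    have hdiv : (N : ℤ) ∣ i - i % N := Int.dvd_self_sub_emod
    have hcard : (Nat.card F : ℤ) ∣ i - i % N := by
      rw [hr.card_eq]
      exact (Int.natCast_dvd_natCast.2 hdvd).trans hdiv
    rw [map_u_eq_of_card_dvd_sub φ₁ hcard, map_u_eq_of_card_dvd_sub φ₂ hcard,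
      ← hr.eval_identificationWord_iff]
    have hnn := Int.emod_nonneg i hN'.ne'
    have hlt := Int.emod_lt_of_pos i hN'
    have h1 := hT (i % N).toNat (by omega)
    rw [Int.toNat_of_nonneg hnn] at h1
    refine h1.resolve_right ?_
    rintro ⟨y, hy, hy1, hy2⟩
    obtain ⟨k, hk⟩ := dvd_add (hy1.trans hdiv) hy2
    refine hx y hy k ?_
    rw [← hk]
    convert hi using 1
    ring
  obtain ⟨φ, h3, h4⟩ := exists_dysonGroup_hom hagree
  have hgen : (fun k => φ (stdGen A k)) = pairGen φ₁ φ₂ := by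
    rw [stdGen, map_pairGen, h3, h4]
  rw [← hgen] at hr
  refine ⟨F, _, φ, hr.describes, ?_⟩
  rw [map_wordValue]
  exact fun h => hw ((hr.eval_eq_one_iff w).2 h)

theorem exists_isCertificate {A : Set ℤ} {q : ℤ → ℤ} (hq : ∀ n ∉ A, q n ≠ 0) {w : GroupWord 4}
    (hw : wordValue (stdGen A) w ≠ 1) :
    ∃ c x, IsCertificate w c x ∧ ∀ y ∈ x.2, y.1 ∉ A ∧ y.2 = q y.1 := by
  classical
  obtain ⟨F, _, _, φ₁, φ₂, h1, h2⟩ := exists_finite_separating_word hw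
    (q := fun n => if n ∈ A then 1 else q n) (fun n => by
      split_ifs with hn
      exacts [one_ne_zero, hq n hn])
  obtain ⟨⟨c, s⟩, hd, hr⟩ := exists_isPairCode φ₁ φ₂
  let T := (Finset.Icc (-(2 * w.length : ℕ) : ℤ) (2 * w.length : ℕ)).filter (· ∉ A)
  have hT : ∀ n ∈ T, n ∉ A := fun n hn => (Finset.mem_filter.1 hn).2
  -- The period is a multiple of the group order and of every modulus used as a witness.
  refine ⟨c, ((s, Nat.card F * ∏ n ∈ T, (q n).natAbs), T.toList.map fun n => (n, q n)),
    ⟨⟨hd, by rwa [Ne, hr.eval_eq_one_iff]⟩, ⟨?_, ?_⟩, fun i _ => ?_⟩, ?_⟩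
  · exact mul_ne_zero Nat.card_pos.ne' (Finset.prod_ne_zero_iff.2 fun n hn =>
      Int.natAbs_ne_zero.2 (hq n (hT n hn)))
  · rw [← hr.card_eq]
    exact dvd_mul_right _ _
  · rw [hr.eval_identificationWord_iff]
    refine (h2 i).imp_right ?_
    rintro ⟨n, hn, hn1, hn2⟩
    rw [if_neg hn] at hn2
    have hnT : n ∈ T := Finset.mem_filter.2 ⟨Finset.mem_Icc.2 (abs_le.1 hn1), hn⟩
    refine ⟨(n, q n), List.mem_map.2 ⟨n, Finset.mem_toList.2 hnT, rfl⟩, ?_, hn2⟩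
    rw [← Int.natAbs_dvd, Int.natCast_dvd_natCast]
    exact Dvd.dvd.mul_left (Finset.dvd_prod_of_mem _ hnT) _
  · rintro y hy
    obtain ⟨n, hn, rfl⟩ := List.mem_map.1 hy
    exact ⟨hT n (Finset.mem_toList.1 hn), rfl⟩

theorem primrecPred_isCertificate :
    PrimrecPred fun t : (GroupWord 4 × MorphismCode) × Certificate =>
      IsCertificate t.1.1 t.1.2 t.2 := by
  have hd : Primrec fun t : (GroupWord 4 × MorphismCode) × Certificate =>
      ((t.1.2, t.2.1.1) : GroupCode) :=
    (Primrec.snd.comp Primrec.fst).pair (Primrec.fst.comp (Primrec.fst.comp Primrec.snd))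
  have hN : Primrec fun t : (GroupWord 4 × MorphismCode) × Certificate => t.2.1.2 :=
    Primrec.snd.comp (Primrec.fst.comp Primrec.snd)
  refine .and (.and (primrecPred_isPairCode.comp hd)
    (primrecPred_eval_eq_one hd (Primrec.fst.comp Primrec.fst)).not)
    (.and (.and (Primrec.eq.comp hN (Primrec.const 0)).not
      (PrimrecRel.nat_dvd.comp (primrec_size.comp hd) hN)) ?_)
  refine PrimrecPred.forall_lt_param
    (p := fun t : ((GroupWord 4 × MorphismCode) × Certificate) × ℕ =>
      eval (t.1.1.2, t.1.2.1.1) (identificationWord t.2) = one (t.1.1.2, t.1.2.1.1) ∨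
        ∃ y ∈ t.1.2.2, y.2 ∣ (t.1.2.1.2 : ℤ) ∧ y.2 ∣ (t.2 : ℤ) - y.1) (.or ?_ ?_) hN
  · exact primrecPred_eval_eq_one (hd.comp Primrec.fst)
      (Primrec.identificationWord.comp (Primrec.int_natCast.comp Primrec.snd))
  · have h : PrimrecRel fun (y : ℤ × ℤ) (z : ℤ × ℤ) => y.2 ∣ z.1 ∧ y.2 ∣ z.2 - y.1 :=
      PrimrecPred.and
        (PrimrecRel.int_dvd.comp (Primrec.snd.comp Primrec.fst) (Primrec.fst.comp Primrec.snd))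
        (PrimrecRel.int_dvd.comp (Primrec.snd.comp Primrec.fst)
          (Primrec.int_sub.comp (Primrec.snd.comp Primrec.snd) (Primrec.fst.comp Primrec.fst)))
    exact h.exists_mem_list.comp (Primrec.snd.comp (Primrec.snd.comp Primrec.fst))
      ((Primrec.int_natCast.comp (hN.comp Primrec.fst)).pair
        (Primrec.int_natCast.comp Primrec.snd))

/-- The algorithm searches for a code with a valid certificate. On inputs from A the closedness
algorithm f may return anything, so each witness must also be confirmed to lie outside A; this is
where A being co-r.e. enters. -/
theorem isEffectivelyResiduallyFinite {A : Set ℤ} (hA : REPred fun n : ℤ => n ∉ A)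
    (hcl : IsEffectivelyClosed A) : IsEffectivelyResiduallyFinite (DysonGroup A) := by
  obtain ⟨f, hf, hfA⟩ := hcl
  have hre : REPred fun t : GroupWord 4 × MorphismCode => ∃ x : Certificate,
      IsCertificate t.1 t.2 x ∧ ∀ y ∈ x.2, y.1 ∉ A ∧ y.2 ∈ f y.1 := by
    refine REPred.exists (p := fun t : (GroupWord 4 × MorphismCode) × Certificate =>
      IsCertificate t.1.1 t.1.2 t.2 ∧ ∀ y ∈ t.2.2, y.1 ∉ A ∧ y.2 ∈ f y.1)
      (primrecPred_isCertificate.re.and ?_)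
    refine REPred.forall_mem_list (p := fun t : ((GroupWord 4 × MorphismCode) × Certificate) ×
      (ℤ × ℤ) => t.2.1 ∉ A ∧ t.2.2 ∈ f t.2.1) ?_ (Primrec.snd.comp Primrec.snd)
    exact (hA.comp (Computable.fst.comp Computable.snd)).and
      ((REPred.mem_graph hf).comp Computable.snd)
  obtain ⟨F, hF, hF1, hF2⟩ := hre.exists_partrec
  have hsound : ∀ w, ∀ c ∈ F w, ∃ (K : Type) (_ : Group K) (φ : DysonGroup A →* K),
      Describes (stdGen A) φ c ∧ φ (wordValue (stdGen A) w) ≠ 1 := by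
    intro w c hc
    obtain ⟨x, hx, hxA⟩ := hF1 w c hc
    refine hx.exists_describes fun y hy k => ?_
    obtain ⟨hyA, hyf⟩ := hxA y hy
    obtain ⟨p, hp, -, hp'⟩ := hfA y.1 hyA
    -- f is single valued, so the modulus in the witness is the one guaranteed to work.
    rw [Part.mem_unique hyf hp]
    exact hp' k
  refine ⟨4, stdGen A, generates_stdGen A, F, hF, fun w => ⟨fun c hc => ?_, fun hw => ?_⟩⟩
  · obtain ⟨K, _, φ, h, -⟩ := hsound w c hc
    exact ⟨K, _, φ, h⟩
  · choose! q hq using hfA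
    obtain ⟨c, x, hx, hxq⟩ := exists_isCertificate (fun n hn => (hq n hn).2.1) hw
    have hdom : (F w).Dom := hF2 w ⟨c, x, hx, fun y hy => ⟨(hxq y hy).1, by
      rw [(hxq y hy).2]
      exact (hq _ (hxq y hy).1).1⟩⟩
    exact ⟨_, Part.get_mem hdom, hsound w _ (Part.get_mem hdom)⟩

end Dyson

theorem proposition1p1 (A : Set ℤ) :
    ((IsREGroup (Dyson.DysonGroup A) ↔ REPred (fun n : ℤ => n ∈ A)) ∧
      (IsCoREGroup (Dyson.DysonGroup A) ↔ REPred (fun n : ℤ => n ∉ A)) ∧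
      (HasSolvableWordProblem (Dyson.DysonGroup A) ↔ ComputablePred (fun n : ℤ => n ∈ A))) ∧
    (Group.ResiduallyFinite (Dyson.DysonGroup A) ↔ @IsClosed ℤ (profiniteTopology ℤ) A) ∧
    (IsEffectivelyResiduallyFinite (Dyson.DysonGroup A) ↔
      REPred (fun n : ℤ => n ∉ A) ∧ IsEffectivelyClosed A) :=
  ⟨⟨⟨Dyson.re_of_isREGroup, Dyson.isREGroup⟩, ⟨Dyson.co_re_of_isCoREGroup, Dyson.isCoREGroup⟩,
    Dyson.hasSolvableWordProblem_iff A⟩, Dyson.residuallyFinite_iff A,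
    ⟨fun h => ⟨Dyson.co_re_of_isCoREGroup h.isCoREGroup,
      Dyson.isEffectivelyClosed_of_isEffectivelyResiduallyFinite h⟩,
      fun h => Dyson.isEffectivelyResiduallyFinite h.1 h.2⟩⟩
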